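/- Let $\mathcal S$ (states) and $\mathcal O$ (observations) be measurable spaces with $\sigma$-finite reference measures (e.g. Lebesgue measure in the continuous case, counting measure in the discrete case), written $\mathrm ds$, $\mathrm do$; let $\mathcal A$ be a finite action set and $H$ the episode length. Consider a class of POMDPs indexed by $\theta\in\Theta$ with common initial state density $\mu$ and reward $r:\mathcal O\times\mathcal A\to[0,1]$, transition densities $\mathcal T^\theta_h(s'\mid s,a)$ ($1\le h\le H$) and emission densities $\mathcal E^\theta_h(o\mid s)$ ($1\le h\le H+1$). A (deterministic) policy $\pi$ chooses $a_h=\pi(o_1,\dots,o_h)$. Write $\tau_h=(o_1,\dots,o_h)$, $\overline\tau_h=(o_1,a_1,\dots,o_{h-1},a_{h-1},o_h)$, let $\overline\Gamma_h$ be the set of all $\overline\tau_h$, and use bold letters for the random variables under the law $\mathbb P_{\theta,\pi}$ of the process. Let $\mathbf r_i=r(\mathbf o_i,\mathbf a_i)$ and $J(\theta,\pi)=\mathbb E_{\theta,\pi}[\sum_{i=1}^H\mathbf r_i]$. Assume that there are probability densities $\psi_1,\dots,\psi_{d}$ on $\mathcal S$ such that $\mu$ (if $H\ge1$) and every $\mathcal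 T^\theta_{h}(\cdot\mid s,a)$ with $1\le h\le H-1$ lie in the convex hull of $\{\psi_i\}$, and functions $\mathcal Z^\theta_h:\mathcal S\times\mathcal O\to\mathbb R$ ($1\le h\le H$) such that $(\mathbb Z^\theta_hf)(s)=\int_{\mathcal O}\mathcal Z^\theta_h(s,o)f(o)\,\mathrm do$ defines a linear operator $L^1(\mathcal O)\to L^1(\mathcal S)$ with $\|\mathbb Z^\theta_h\|_{1\to1}\le\gamma$ for some $\gamma>0$, and $\mathbb Z^\theta_h\mathbb O^\theta_hf=f$ for all $f\in\mathrm{span}\{\psi_i\}$, where $(\mathbb O^\theta_hf)(o)=\int_{\mathcal S}\mathcal E^\theta_h(o\mid s)f(s)\,\mathrm ds$. For $1\le h\le H$ and $f\in L^\infty(\overline\Gamma_{h+1})$ define the full-memory Bellman operator $$(\mathbb P^{\theta,\pi}_hf)(\overline\tau_h)=\int_{\mathcal O}f(\overline\tau_h,\pi(\tau_h),o')\,p_\theta\bigl(\mathbf o_{h+1}=o'\mid\overline{\boldsymbol\tau}_h=\overline\tau_h,\mathbf a_h=\pi(\tau_h)\bigr)\,\mathrm do'$$ and the finite-memory Bellman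 operator $$(\mathbb B^{\theta,\pi}_hf)(\overline\tau_h)=\int_{\mathcal O^2}f(\overline\tau_h^\dagger,\pi(\tau_h^\dagger),\tilde o')\,\mathcal B^\theta_{h,\pi(\tau_h^\dagger)}(o_h,\tilde o,\tilde o')\,\mathrm d\tilde o\,\mathrm d\tilde o',$$ $$\mathcal B^\theta_{h,a}(o,\tilde o,\tilde o')=\int_{\mathcal S}p_\theta(\mathbf o_h=\tilde o,\mathbf o_{h+1}=\tilde o'\mid\mathbf s_h=s,\mathbf a_h=a)\,\mathcal Z^\theta_h(s,o)\,\mathrm ds,$$ where $\overline\tau_h^\dagger,\tau_h^\dagger$ are $\overline\tau_h,\tau_h$ with the last observation $o_h$ replaced by $\tilde o$. Let $R(\overline\tau_{H+1})=\sum_{i=1}^Hr(o_i,a_i)$ and $V^{\theta,\pi}_h=\mathbb B^{\theta,\pi}_h\cdots\mathbb B^{\theta,\pi}_HR$ for $1\le h\le H+1$ (so $V^{\theta,\pi}_{H+1}=R$). Let $\sigma_{h-1}$ denote conditioning on $(\overline{\boldsymbol\tau}_{h-1},\mathbf a_{h-1})$ (no conditioning if $h=1$), where the actions $a_1,\dots,a_{h-1}$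 may be chosen by intervention: they are produced by an arbitrary policy $\pi'$ (for instance by fixed actions, or by $\pi$ itself). Conditional expectations are understood almost surely under the resulting law. Then for all $\theta$ and $\pi$: 1. For every $1\le h\le H$ and $f\in L^\infty(\overline\Gamma_{h+1})$, the functions $\mathbb B^{\theta,\pi}_hf$ and $\mathbb P^{\theta,\pi}_hf$ belong to $L^\infty(\overline\Gamma_h)$, and for every policy $\pi'$ $$\mathbb E_{\theta,\pi'}\bigl[(\mathbb B^{\theta,\pi}_hf)(\overline{\boldsymbol\tau}_h)-(\mathbb P^{\theta,\pi}_hf)(\overline{\boldsymbol\tau}_h)\mid\sigma_{h-1}\bigr]=0 .$$ 2. For every $1\le h\le H+1$, $V^{\theta,\pi}_h\in L^\infty(\overline\Gamma_h)$, and for every policy $\pi'$ that agrees with $\pi$ at the steps $h,\dots,H$, $$\mathbb E_{\theta,\pi'}\Bigl[V^{\theta,\pi}_h(\overline{\boldsymbol\tau}_h)-\sum_{i=1}^H\mathbf r_i\Bigm|\sigma_{h-1}\Bigr]=0 .$$ 3. $J(\theta,\pi)=\mathbb E[V^{\theta,\pi}_1(\mathbf o_1)]$, where $\mathbf o_1$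 has its law under $\theta$ (equivalently, under any $\theta'$ with $\mathcal E^{\theta'}_1=\mathcal E^\theta_1$ and under any policy). -/

import Mathlib

open MeasureTheory Filter
open scoped ENNReal

/-- `p ∈ Δ(X)`: a probability density with respect to the reference measure `m` (Lebesgue measure
for a continuous space, counting measure for a discrete one). -/
structure IsDensity {X : Type*} [MeasurableSpace X] (m : Measure X) (p : X → ℝ) : Prop where
  measurable : Measurable p
  nonneg : ∀ x, 0 ≤ p x
  integral_eq_one : ∫ x, p x ∂m = 1

/-- A candidate class of episodic POMDPs. All kernels are given by their densities with respect
to `ν` on states and `ρ` on observations. Steps are counted from `0`: the step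
`h = 1, 2, …` of the usual one-based count is `k = h - 1`, so the trajectory has the steps `0, …, H` (the last one carries a
state and an observation only), `trans θ k s a s'` is the density of the state `s'` at step `k + 1`
given the state `s` and the action `a` at step `k`, and `emit θ k s o` is the density of the
observation `o` given the state `s` at step `k`. -/
structure POMDPClass (Θ S A O : Type*) [MeasurableSpace S] [MeasurableSpace A]
    [MeasurableSpace O] (ν : Measure S) (ρ : Measure O) where
  H : ℕ
  init : S → ℝ
  trans : Θ → ℕ → S → A → S → ℝ
  emit : Θ → ℕ → S → O → ℝ
  reward : O → A → ℝ
  init_density : IsDensity ν init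
  trans_measurable : ∀ θ k, k < H →
    Measurable (fun p : S × A × S => trans θ k p.1 p.2.1 p.2.2)
  trans_density : ∀ θ k, k < H → ∀ s a, IsDensity ν (trans θ k s a)
  emit_measurable : ∀ θ k, k ≤ H → Measurable (fun p : S × O => emit θ k p.1 p.2)
  emit_density : ∀ θ k, k ≤ H → ∀ s, IsDensity ρ (emit θ k s)
  reward_measurable : Measurable (fun p : O × A => reward p.1 p.2)
  reward_mem : ∀ o a, reward o a ∈ Set.Icc (0 : ℝ) 1

/-- A deterministic policy: at step `k` it maps the observations of the steps `0, …, k` to an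
action. -/
structure Policy (A O : Type*) [MeasurableSpace A] [MeasurableSpace O] where
  act : (k : ℕ) → (Fin (k + 1) → O) → A
  measurable_act : ∀ k, Measurable (act k)

/-- Full histories up to step `k`: the observations of the steps `0, …, k` and the actions of the
steps `0, …, k - 1`. -/
abbrev Hist (A O : Type*) (k : ℕ) : Type _ := (Fin (k + 1) → O) × (Fin k → A)

/-- The reference measure on full histories; `L^∞` of the space of histories refers to it. -/
noncomputable def histMeasure (A : Type*) {O : Type*} [MeasurableSpace A] [MeasurableSpace O]
    (ρ : Measure O) (k : ℕ) : Measure (Hist A O k) :=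
  (Measure.pi (fun _ : Fin (k + 1) => ρ)).prod Measure.count

/-- `(τ, a, o)`: append an action and the next observation. -/
def Hist.extend {A O : Type*} {k : ℕ} (τ : Hist A O k) (a : A) (o : O) : Hist A O (k + 1) :=
  (Fin.snoc (α := fun _ => O) τ.1 o, Fin.snoc (α := fun _ => A) τ.2 a)

/-- The tail-mirrored history: the last observation is replaced by `o`. -/
def Hist.mirror {A O : Type*} {k : ℕ} (τ : Hist A O k) (o : O) : Hist A O k :=
  (Function.update τ.1 (Fin.last k) o, τ.2)

/-- The observations of the first `k` steps of a trajectory `ω = ((s₀, o₀), …, (sₙ, oₙ))`. -/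
def obsUpTo {S O : Type*} {n : ℕ} (ω : Fin (n + 1) → S × O) (k : ℕ) (hk : k ≤ n + 1) :
    Fin k → O :=
  fun j => (ω (Fin.castLE hk j)).2

namespace Policy

variable {S A O : Type*} [MeasurableSpace A] [MeasurableSpace O]

/-- The actions of the first `k` steps of a trajectory on which `π` is executed. -/
def actsUpTo (π : Policy A O) {n : ℕ} (ω : Fin (n + 1) → S × O) (k : ℕ) (hk : k ≤ n + 1) :
    Fin k → A :=
  fun j => π.act j (obsUpTo ω (j + 1) (by omega))

/-- The random full history up to step `k`. -/
def hist (π : Policy A O) {n : ℕ} (k : ℕ) (hk : k ≤ n) (ω : Fin (n + 1) → S × O) : Hist A O k :=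
  (obsUpTo ω (k + 1) (by omega), π.actsUpTo ω k (by omega))

/-- The random conditioning variable for step `k`: the full history up to step `k - 1` together
with the action of step `k - 1`, that is, all observations and all actions of the steps
`0, …, k - 1` (no information if `k = 0`). -/
def past (π : Policy A O) {n : ℕ} (k : ℕ) (hk : k ≤ n) (ω : Fin (n + 1) → S × O) :
    (Fin k → O) × (Fin k → A) :=
  (obsUpTo ω k (by omega), π.actsUpTo ω k (by omega))

/-- The σ-algebra generated by `past`. -/
abbrev pastSigma [MeasurableSpace S] (π : Policy A O) {n : ℕ} (k : ℕ) (hk : k ≤ n) :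
    MeasurableSpace (Fin (n + 1) → S × O) :=
  MeasurableSpace.comap (π.past k hk) inferInstance

end Policy

namespace POMDPClass

variable {Θ S A O : Type*} [MeasurableSpace S] [MeasurableSpace A] [MeasurableSpace O]
  {ν : Measure S} {ρ : Measure O}

/-- The joint density of states and observations of the steps `0, …, n` under parameter `θ` and
policy `π`. -/
noncomputable def trajDensity (M : POMDPClass Θ S A O ν ρ) (θ : Θ) (π : Policy A O) (n : ℕ)
    (ω : Fin (n + 1) → S × O) : ℝ :=
  M.init (ω 0).1 * (∏ i : Fin (n + 1), M.emit θ i (ω i).1 (ω i).2) *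
    ∏ i : Fin n, M.trans θ i (ω i.castSucc).1 (π.act i (obsUpTo ω (i + 1) (by omega)))
      (ω i.succ).1

/-- The law of the trajectory under `θ` and `π`. -/
noncomputable def law (M : POMDPClass Θ S A O ν ρ) (θ : Θ) (π : Policy A O) :
    Measure (Fin (M.H + 1) → S × O) :=
  (Measure.pi (fun _ : Fin (M.H + 1) => ν.prod ρ)).withDensity
    (fun ω => ENNReal.ofReal (M.trajDensity θ π M.H ω))

/-- The total reward of the trajectory when `π` is executed. -/
noncomputable def trajReward (M : POMDPClass Θ S A O ν ρ) (π : Policy A O)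
    (ω : Fin (M.H + 1) → S × O) : ℝ :=
  ∑ i : Fin M.H, M.reward (ω i.castSucc).2 (π.act i (obsUpTo ω (i + 1) (by omega)))

/-- `J(θ, π)`, the expected total reward. -/
noncomputable def J (M : POMDPClass Θ S A O ν ρ) (θ : Θ) (π : Policy A O) : ℝ :=
  ∫ ω, M.trajReward π ω ∂(M.law θ π)

/-- The sum of the rewards along a history; for `k = H` this is the function `R`. -/
noncomputable def histReward (M : POMDPClass Θ S A O ν ρ) {k : ℕ} (τ : Hist A O k) : ℝ :=
  ∑ i : Fin k, M.reward (τ.1 i.castSucc) (τ.2 i)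

/-- The density of the observation `o'` of step `k + 1` given state `s` and action `a` of
step `k`. -/
noncomputable def nextObs (M : POMDPClass Θ S A O ν ρ) (θ : Θ) (k : ℕ) (s : S) (a : A) (o' : O) :
    ℝ :=
  ∫ s', M.emit θ (k + 1) s' o' * M.trans θ k s a s' ∂ν

/-- The joint density at `s` of the state of step `k` and at `τ` of the observations of the steps
`0, …, k`, when the actions of the steps `0, …, k - 1` are those of `τ`. -/
noncomputable def forward (M : POMDPClass Θ S A O ν ρ) (θ : Θ) : (k : ℕ) → Hist A O k → S → ℝ
  | 0, τ, s => M.emit θ 0 s (τ.1 0) * M.init s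
  | k + 1, τ, s' => M.emit θ (k + 1) s' (τ.1 (Fin.last (k + 1))) *
      ∫ s, M.trans θ k s (τ.2 (Fin.last k)) s' *
        M.forward θ k (fun i => τ.1 i.castSucc, fun i => τ.2 i.castSucc) s ∂ν

/-- The conditional density of the observation of step `k + 1` given the full history `τ` up to
step `k` and the action `a` of step `k` (Bayes' rule). -/
noncomputable def predObs (M : POMDPClass Θ S A O ν ρ) (θ : Θ) (k : ℕ) (τ : Hist A O k) (a : A)
    (o' : O) : ℝ :=
  (∫ s, M.nextObs θ k s a o' * M.forward θ k τ s ∂ν) / ∫ s, M.forward θ k τ s ∂ν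

/-- The full-memory Bellman operator `ℙ`. -/
noncomputable def fullBellman (M : POMDPClass Θ S A O ν ρ) (θ : Θ) (π : Policy A O) (k : ℕ)
    (f : Hist A O (k + 1) → ℝ) (τ : Hist A O k) : ℝ :=
  ∫ o', f (τ.extend (π.act k τ.1) o') * M.predObs θ k τ (π.act k τ.1) o' ∂ρ

/-- The kernel `𝓑(o, õ, õ')` at step `k` and action `a`: the joint density of the observations
`(õ, õ')` of the steps `k, k + 1` given the state `s` and the action `a` of step `k`, integrated
against the bridge function `Z θ k s o` over `s`. -/
noncomputable def bellmanKernel (M : POMDPClass Θ S A O ν ρ) (Z : Θ → ℕ → S → O → ℝ) (θ : Θ)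
    (k : ℕ) (a : A) (o o₁ o₂ : O) : ℝ :=
  ∫ s, (M.emit θ k s o₁ * M.nextObs θ k s a o₂) * Z θ k s o ∂ν

/-- The finite-memory Bellman operator `𝔹`. -/
noncomputable def finBellman (M : POMDPClass Θ S A O ν ρ) (Z : Θ → ℕ → S → O → ℝ) (θ : Θ)
    (π : Policy A O) (k : ℕ) (f : Hist A O (k + 1) → ℝ) (τ : Hist A O k) : ℝ :=
  ∫ p : O × O, f ((τ.mirror p.1).extend (π.act k (τ.mirror p.1).1) p.2) *
    M.bellmanKernel Z θ k (π.act k (τ.mirror p.1).1) (τ.1 (Fin.last k)) p.1 p.2 ∂(ρ.prod ρ)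

/-- The value function `V_k = 𝔹_k 𝔹_{k+1} ⋯ 𝔹_{H-1} R` for `k ≤ H` (so `V_H = R`). -/
noncomputable def value (M : POMDPClass Θ S A O ν ρ) (Z : Θ → ℕ → S → O → ℝ) (θ : Θ)
    (π : Policy A O) (k : ℕ) : Hist A O k → ℝ :=
  if k < M.H then M.finBellman Z θ π k (M.value Z θ π (k + 1)) else M.histReward
termination_by M.H - k

/-- The class `𝓕_s` of conditional state densities of the steps `0, …, H - 1` given the previous
state and action; at step `0` this is the initial density. -/
def stateDensities (M : POMDPClass Θ S A O ν ρ) : Set (S → ℝ) :=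
  {p | (0 < M.H ∧ p = M.init) ∨ ∃ θ k s a, k + 1 < M.H ∧ p = M.trans θ k s a}

/-- Every density in `𝓕_s` is (as an element of `L¹`) a convex combination of the `ψ i`. -/
def LinearStates (M : POMDPClass Θ S A O ν ρ) {d : ℕ} (ψ : Fin d → S → ℝ) : Prop :=
  ∀ p ∈ M.stateDensities, ∃ q ∈ convexHull ℝ (Set.range ψ), p =ᵐ[ν] q

/-- The observation operator `𝕆 : L¹(S) → L¹(O)`. -/
noncomputable def obsOp (M : POMDPClass Θ S A O ν ρ) (θ : Θ) (k : ℕ) (f : S → ℝ) (o : O) : ℝ :=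
  ∫ s, M.emit θ k s o * f s ∂ν

/-- `Z` is a family of integral kernels of bounded operators `ℤ : L¹(O) → L¹(S)` of norm at most
`γ`, and `ℤ 𝕆 f = f` for every `f` in the linear span of the `ψ i`. -/
structure InvertibleObs (M : POMDPClass Θ S A O ν ρ) {d : ℕ} (ψ : Fin d → S → ℝ)
    (Z : Θ → ℕ → S → O → ℝ) (γ : ℝ) : Prop where
  measurable : ∀ θ k, k < M.H → Measurable (fun p : S × O => Z θ k p.1 p.2)
  integrable_kernel : ∀ θ k, k < M.H → ∀ f : O → ℝ, Integrable f ρ →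
    ∀ᵐ s ∂ν, Integrable (fun o => Z θ k s o * f o) ρ
  integrable : ∀ θ k, k < M.H → ∀ f : O → ℝ, Integrable f ρ →
    Integrable (fun s => ∫ o, Z θ k s o * f o ∂ρ) ν
  norm_le : ∀ θ k, k < M.H → ∀ f : O → ℝ, Integrable f ρ →
    ∫ s, |∫ o, Z θ k s o * f o ∂ρ| ∂ν ≤ γ * ∫ o, |f o| ∂ρ
  left_inv : ∀ θ k, k < M.H → ∀ f ∈ Submodule.span ℝ (Set.range ψ),
    (fun s => ∫ o, Z θ k s o * M.obsOp θ k f o ∂ρ) =ᵐ[ν] f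

end POMDPClass

namespace POMDPClass
variable {Θ S A O : Type*} [MeasurableSpace S] [MeasurableSpace A] [MeasurableSpace O]
  {ν : Measure S} {ρ : Measure O}

theorem _root_.IsDensity.lintegral {X : Type*} [MeasurableSpace X] {m : Measure X} {p : X → ℝ}
    (h : IsDensity m p) : ∫⁻ x, ENNReal.ofReal (p x) ∂m = 1 := by
  have hi : Integrable p m := by
    by_contra hc
    have := h.integral_eq_one
    rw [integral_undef hc] at this
    exact zero_ne_one this
  rw [← ofReal_integral_eq_lintegral_ofReal hi (Eventually.of_forall h.nonneg),
    h.integral_eq_one, ENNReal.ofReal_one]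

theorem measurable_obsUpTo {n k : ℕ} (hk : k ≤ n + 1) :
    Measurable (fun ω : Fin (n + 1) → S × O => obsUpTo ω k hk) := by
  unfold obsUpTo; fun_prop

theorem measurable_trajDensity (M : POMDPClass Θ S A O ν ρ) (θ : Θ) (π : Policy A O) (n : ℕ)
    (hn : n ≤ M.H) : Measurable (M.trajDensity θ π n) := by
  unfold trajDensity
  refine Measurable.mul (Measurable.mul ?_ ?_) ?_
  · exact M.init_density.measurable.comp (by fun_prop)
  · refine Finset.measurable_prod _ fun i _ => ?_
    exact (M.emit_measurable θ i (by omega)).comp (by fun_prop)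
  · refine Finset.measurable_prod _ fun i _ => ?_
    have hg : Measurable (fun ω : Fin (n + 1) → S × O => ((ω i.castSucc).1,
        π.act i (obsUpTo ω (i + 1) (by omega)), (ω i.succ).1)) :=
      Measurable.prodMk (by fun_prop) (Measurable.prodMk
        ((π.measurable_act i).comp (measurable_obsUpTo _)) (by fun_prop))
    exact (M.trans_measurable θ i (by omega)).comp hg

theorem trajDensity_snoc (M : POMDPClass Θ S A O ν ρ) (θ : Θ) (π : Policy A O) (n : ℕ)
    (ω : Fin (n + 1) → S × O) (x : S × O) :
    M.trajDensity θ π (n + 1) (Fin.snoc (α := fun _ => S × O) ω x) =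
      M.trajDensity θ π n ω *
        (M.trans θ n (ω (Fin.last n)).1 (π.act n (obsUpTo ω (n + 1) le_rfl)) x.1 *
          M.emit θ (n + 1) x.1 x.2) := by
  have hobs : ∀ k (hk : k ≤ n + 1), obsUpTo (Fin.snoc (α := fun _ => S × O) ω x) k
      (by omega : k ≤ n + 1 + 1) = obsUpTo ω k hk := by
    intro k hk
    funext j
    unfold obsUpTo
    have : Fin.castLE (by omega : k ≤ n + 1 + 1) j = (Fin.castLE hk j).castSucc := rfl
    rw [this, Fin.snoc_castSucc]
  have h0 : (Fin.snoc (α := fun _ => S × O) ω x : Fin (n + 2) → S × O) 0 = ω 0 := by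
    rw [← Fin.castSucc_zero, Fin.snoc_castSucc]
  have hE : ∏ i : Fin (n + 2), M.emit θ i
        ((Fin.snoc (α := fun _ => S × O) ω x : Fin (n + 2) → S × O) i).1
        ((Fin.snoc (α := fun _ => S × O) ω x : Fin (n + 2) → S × O) i).2 =
      (∏ i : Fin (n + 1), M.emit θ i (ω i).1 (ω i).2) * M.emit θ (n + 1) x.1 x.2 := by
    rw [Fin.prod_univ_castSucc]
    simp only [Fin.snoc_castSucc, Fin.snoc_last, Fin.val_castSucc, Fin.val_last]
  have hT : ∏ i : Fin (n + 1), M.trans θ i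
        ((Fin.snoc (α := fun _ => S × O) ω x : Fin (n + 2) → S × O) i.castSucc).1
        (π.act i (obsUpTo (Fin.snoc (α := fun _ => S × O) ω x : Fin (n + 2) → S × O)
          (i + 1) (by omega)))
        ((Fin.snoc (α := fun _ => S × O) ω x : Fin (n + 2) → S × O) i.succ).1 =
      (∏ i : Fin n, M.trans θ i (ω i.castSucc).1
        (π.act i (obsUpTo ω (i + 1) (by omega))) (ω i.succ).1) *
      M.trans θ n (ω (Fin.last n)).1 (π.act n (obsUpTo ω (n + 1) le_rfl)) x.1 := by
    rw [Fin.prod_univ_castSucc]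
    congr 1
    · refine Finset.prod_congr rfl fun i _ => ?_
      rw [Fin.snoc_castSucc, Fin.succ_castSucc, Fin.snoc_castSucc]
      simp only [Fin.val_castSucc]
      rw [hobs (i + 1) (by omega)]
    · rw [Fin.snoc_castSucc, Fin.succ_last, Fin.snoc_last]
      simp only [Fin.val_last]
      rw [hobs (n + 1) le_rfl]
  unfold trajDensity
  rw [h0, hE, hT]
  ring

theorem trajDensity_nonneg (M : POMDPClass Θ S A O ν ρ) (θ : Θ) (π : Policy A O) (n : ℕ)
    (hn : n ≤ M.H) (ω) : 0 ≤ M.trajDensity θ π n ω := by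
  unfold trajDensity
  refine mul_nonneg (mul_nonneg (M.init_density.nonneg _) ?_) ?_
  · exact Finset.prod_nonneg fun i _ => (M.emit_density θ i (by omega) _).nonneg _
  · exact Finset.prod_nonneg fun i _ => (M.trans_density θ i (by omega) _ _).nonneg _

theorem lintegral_trajDensity [SigmaFinite ν] [SigmaFinite ρ]
    (M : POMDPClass Θ S A O ν ρ) (θ : Θ) (π : Policy A O) (n : ℕ) (hn : n ≤ M.H) :
    ∫⁻ ω, ENNReal.ofReal (M.trajDensity θ π n ω)
      ∂(Measure.pi (fun _ : Fin (n + 1) => ν.prod ρ)) = 1 := by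
  have step : ∀ k, k ≤ M.H → ∀ p : S → ℝ, IsDensity ν p →
      ∫⁻ x, ENNReal.ofReal (p x.1 * M.emit θ k x.1 x.2) ∂(ν.prod ρ) = 1 := by
    intro k hk p hp
    rw [lintegral_prod]
    · have : ∀ s, ∫⁻ o, ENNReal.ofReal (p s * M.emit θ k s o) ∂ρ = ENNReal.ofReal (p s) := by
        intro s
        simp_rw [ENNReal.ofReal_mul (hp.nonneg s)]
        rw [lintegral_const_mul' _ _ ENNReal.ofReal_ne_top, (M.emit_density θ k hk s).lintegral,
          mul_one]
      simp_rw [this]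
      exact hp.lintegral
    · exact ((hp.measurable.comp measurable_fst).mul
        (M.emit_measurable θ k hk)).ennreal_ofReal.aemeasurable
  induction n with
  | zero =>
    have h := ((measurePreserving_funUnique (ν.prod ρ) (Fin 1)).symm _).lintegral_comp
      (M.measurable_trajDensity θ π 0 hn).ennreal_ofReal
    refine Eq.trans h.symm ?_
    simpa [trajDensity, MeasurableEquiv.funUnique] using step 0 hn M.init M.init_density
  | succ n ih =>
    rw [← ((measurePreserving_piFinSuccAbove (fun _ : Fin (n + 2) => ν.prod ρ)
      (Fin.last (n + 1))).symm _).lintegral_comp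
      (M.measurable_trajDensity θ π (n + 1) hn).ennreal_ofReal]
    rw [lintegral_prod_symm]
    · rw [← ih (by omega)]
      refine lintegral_congr fun ω => ?_
      have : ∀ x : S × O, (MeasurableEquiv.piFinSuccAbove (fun _ : Fin (n + 2) => S × O)
          (Fin.last (n + 1))).symm (x, ω) = Fin.snoc (α := fun _ => S × O) ω x := by
        intro x
        simp [MeasurableEquiv.piFinSuccAbove, Fin.insertNthEquiv]
      simp only [this, trajDensity_snoc,
        ENNReal.ofReal_mul (M.trajDensity_nonneg θ π n (by omega) ω)]
      rw [lintegral_const_mul' _ _ ENNReal.ofReal_ne_top,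
        step (n + 1) hn _ (M.trans_density θ n (by omega) _ _), mul_one]
    · exact ((M.measurable_trajDensity θ π (n + 1) hn).ennreal_ofReal.comp
        (MeasurableEquiv.measurable _)).aemeasurable

instance isProbabilityMeasure_law [SigmaFinite ν] [SigmaFinite ρ] (M : POMDPClass Θ S A O ν ρ) (θ : Θ) (π : Policy A O) :
    IsProbabilityMeasure (M.law θ π) := by
  constructor
  rw [law, withDensity_apply _ MeasurableSet.univ, Measure.restrict_univ]
  exact M.lintegral_trajDensity θ π M.H le_rfl

end POMDPClass

/-! Fix a step `k` and condition on all states and observations of the steps before `k`, not only on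
the observable past. The state of step `k` then has density `p = M.priorDensity θ π' k x`, which is
the initial density or a single transition density; for `k < M.H` it agrees a.e. with a point of the
convex hull of the `ψ i`, and so `ℤ 𝕆 p = p`. Let `Ψ s` be the mean of `f` at the next step when the
observation of step `k` is drawn anew from `s` and `π` acts on the altered history. The observation
to be replaced does not enter `Ψ`. Hence `𝔹 f`, as a function of the last observation `o`, is `∫ Ψ s
* Z s o`, and its mean is `∫ (∫ Ψ s * Z s o ds) (𝕆 p) o do = ∫ Ψ s (ℤ 𝕆 p) s ds = ∫ Ψ s * p s ds`.
The right-hand side is the mean of `stateBellman`, the expectation of `f` at the next step given the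
history and the latent state. This is `integral_finBellman_eq_integral_stateBellman`.

By Bayes' rule for the forward density (`fullBellman_mul_integral_forward`), `ℙ f` has the same
mean. If the executed policy acts like `π` at step `k`, so does `f` at the next history
(`integral_next_eq_stateBellman`). All three comparisons survive multiplication by a bounded
function of the earlier observations, which gives the conditional statements. Backward induction
replaces `V_k` by `V_{k+1}` under the integral over any event of the past, until the total reward is
reached.

The analytic difficulty is the interchange of integrals. The hypotheses bound `ℤ` only as an
operator, while Fubini needs control of `|Z|`. `ae_lintegral_kernel_le` supplies `∫ |Z s o| ds ≤ γ`
for almost every `o`; it also gives the essential bound on `𝔹 f`.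

The remaining work makes the conditioning rigorous: the trajectory law is rebuilt as an iterated
composition of Markov kernels, `forward` is identified as a joint density, and the operators are
shown to respect null sets of histories. -/

open ProbabilityTheory

/-! ### From the operator norm to the L¹ norms of the kernel sections. -/

/-- Finite unions of measurable rectangles, presented as families of measurable sets of the first
factor indexed by a finite measurable partition of the second. -/
def finiteRectangles (X Y : Type*) [MeasurableSpace X] [MeasurableSpace Y] : Set (Set (X × Y)) :=
  {E | ∃ (ι : Type) (_ : Fintype ι) (N : Y → ι) (A : ι → Set X),
    (∀ i, MeasurableSet (N ⁻¹' {i})) ∧ (∀ i, MeasurableSet (A i)) ∧ E = {p | p.1 ∈ A (N p.2)}}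

section finiteRectangles

variable {X Y : Type*} [MeasurableSpace X] [MeasurableSpace Y]

theorem rectangle_mem_finiteRectangles {s : Set X} {t : Set Y} (hs : MeasurableSet s)
    (ht : MeasurableSet t) : s ×ˢ t ∈ finiteRectangles X Y := by
  classical
  refine ⟨Bool, inferInstance, fun y => decide (y ∈ t), fun b => if b then s else ∅, ?_, ?_, ?_⟩
  · rintro (_ | _)
    · convert ht.compl using 1; ext y; simp
    · convert ht using 1; ext y; simp
  · rintro (_ | _) <;> simp [hs]
  · ext ⟨x, y⟩
    by_cases h : y ∈ t <;> simp [h]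

/-- For unions, pass to the common refinement of the two partitions of the second factor, indexed by
`ι × κ`. -/
theorem isSetAlgebra_finiteRectangles : IsSetAlgebra (finiteRectangles X Y) where
  empty_mem := by
    simpa using rectangle_mem_finiteRectangles (X := X) (Y := Y) MeasurableSet.empty
      MeasurableSet.empty
  compl_mem := by
    rintro _ ⟨ι, _, N, A, hN, hA, rfl⟩
    exact ⟨ι, inferInstance, N, fun i => (A i)ᶜ, hN, fun i => (hA i).compl, rfl⟩
  union_mem := by
    rintro _ _ ⟨ι, _, N, A, hN, hA, rfl⟩ ⟨κ, _, N', A', hN', hA', rfl⟩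
    refine ⟨ι × κ, inferInstance, fun y => (N y, N' y), fun i => A i.1 ∪ A' i.2, ?_,
      fun i => (hA _).union (hA' _), rfl⟩
    rintro ⟨i, j⟩
    convert (hN i).inter (hN' j) using 1
    ext y; simp

theorem generateFrom_finiteRectangles :
    (Prod.instMeasurableSpace : MeasurableSpace (X × Y)) =
      MeasurableSpace.generateFrom (finiteRectangles X Y) := by
  apply le_antisymm
  · rw [← generateFrom_prod]
    refine MeasurableSpace.generateFrom_mono ?_
    rintro _ ⟨s, hs, t, ht, rfl⟩
    exact rectangle_mem_finiteRectangles hs ht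
  · refine MeasurableSpace.generateFrom_le ?_
    rintro _ ⟨ι, _, N, A, hN, hA, rfl⟩
    have : {p : X × Y | p.1 ∈ A (N p.2)} = ⋃ i, A i ×ˢ (N ⁻¹' {i}) := by
      ext p; simp
    rw [this]
    exact MeasurableSet.iUnion fun i => (hA i).prod (hN i)

/-- If a kernel maps every indicator of a measurable set to a function of norm at most `γ` times
the measure of the set, then so does its absolute value. -/
theorem integral_abs_kernel_le {μ : Measure X} {η : Measure Y} [SFinite μ] [IsFiniteMeasure η]
    {Z : X × Y → ℝ} (hZ : Measurable Z) (hi : Integrable Z (μ.prod η)) {γ : ℝ}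
    (hγ : ∀ B, MeasurableSet B → ∫ x, |∫ y in B, Z (x, y) ∂η| ∂μ ≤ γ * η.real B) :
    ∫ p, |Z p| ∂(μ.prod η) ≤ γ * η.real Set.univ := by
  classical
  -- For such `E` the sign is, at fixed `x`, constant in `y` on each cell of a finite partition of
  -- `Y`. The hypothesis applies cell by cell, and the bounds `γ * η(cell)` add up to `γ * η(Y)`,
  -- however fine the partition.
  have key : ∀ E ∈ finiteRectangles X Y,
      ∫ p, (if p ∈ E then 1 else -1) * Z p ∂(μ.prod η) ≤ γ * η.real Set.univ := by
    intro E hE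
    have hEm : MeasurableSet E := by
      rw [generateFrom_finiteRectangles]; exact MeasurableSpace.measurableSet_generateFrom hE
    obtain ⟨ι, _, N, A, hN, hA, rfl⟩ := hE
    have hsign : Measurable (fun p : X × Y => if p ∈ {p : X × Y | p.1 ∈ A (N p.2)} then (1 : ℝ)
        else -1) := Measurable.ite hEm measurable_const measurable_const
    have hgi : Integrable (fun p => (if p ∈ {p : X × Y | p.1 ∈ A (N p.2)} then (1 : ℝ)
        else -1) * Z p) (μ.prod η) := by
      refine hi.mono (hsign.mul hZ).aestronglyMeasurable (Eventually.of_forall fun p => ?_)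
      rw [norm_mul]
      split_ifs <;> simp
    have hU : (⋃ i, N ⁻¹' {i}) = Set.univ := by ext y; simp
    have hD : Pairwise (Function.onFun Disjoint fun i => N ⁻¹' {i}) := by
      intro i j hij
      refine Set.disjoint_left.2 fun y hy hy' => hij ?_
      rw [← hy, ← hy']
    rw [integral_prod _ hgi]
    have h1 : ∀ᵐ x ∂μ, ∫ y, (if (x, y) ∈ {p : X × Y | p.1 ∈ A (N p.2)} then (1 : ℝ)
        else -1) * Z (x, y) ∂η ≤ ∑ i, |∫ y in N ⁻¹' {i}, Z (x, y) ∂η| := by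
      filter_upwards [hgi.prod_right_ae] with x hx
      rw [← setIntegral_univ, ← hU, integral_iUnion_fintype hN hD (fun i => hx.integrableOn)]
      refine Finset.sum_le_sum fun i _ => ?_
      have : ∫ y in N ⁻¹' {i}, (if (x, y) ∈ {p : X × Y | p.1 ∈ A (N p.2)} then (1 : ℝ)
          else -1) * Z (x, y) ∂η = (if x ∈ A i then (1 : ℝ) else -1) *
            ∫ y in N ⁻¹' {i}, Z (x, y) ∂η := by
        rw [← integral_const_mul]
        refine setIntegral_congr_fun (hN i) fun y hy => ?_
        have : N y = i := hy
        simp [this]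
      refine this.le.trans ((le_abs_self _).trans ?_)
      rw [abs_mul]
      split_ifs <;> simp
    have h2 : ∀ i, Integrable (fun x => |∫ y in N ⁻¹' {i}, Z (x, y) ∂η|) μ := by
      intro i
      have : Integrable Z (μ.prod (η.restrict (N ⁻¹' {i}))) := by
        have := hi.integrableOn (s := Set.univ ×ˢ (N ⁻¹' {i}))
        rwa [IntegrableOn, ← Measure.prod_restrict, Measure.restrict_univ] at this
      exact this.integral_prod_left.abs
    calc _ ≤ ∫ x, ∑ i, |∫ y in N ⁻¹' {i}, Z (x, y) ∂η| ∂μ :=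
          integral_mono_ae hgi.integral_prod_left (integrable_finsetSum _ fun i _ => h2 i) h1
      _ = ∑ i, ∫ x, |∫ y in N ⁻¹' {i}, Z (x, y) ∂η| ∂μ := integral_finsetSum _ fun i _ => h2 i
      _ ≤ ∑ i, γ * η.real (N ⁻¹' {i}) := Finset.sum_le_sum fun i _ => hγ _ (hN i)
      _ = γ * η.real Set.univ := by
          rw [← Finset.mul_sum, ← hU, measureReal_iUnion_fintype hD hN]
  refine le_of_forall_pos_le_add fun e he => ?_
  have hPm : MeasurableSet {p | 0 ≤ Z p} := measurableSet_le measurable_const hZ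
  -- The true sign set `{0 ≤ Z}` is approximated by the algebra in the finite measure `|Z| d(μ ×
  -- η)`. A wrong sign on the symmetric difference costs `2 |Z|`, whence the tolerance `e / 2`.
  set m := (μ.prod η).withDensity (fun p => ‖Z p‖ₑ) with hm
  have : IsFiniteMeasure m := isFiniteMeasure_withDensity hi.2.ne
  obtain ⟨E, hE, hEP⟩ := exists_measure_symmDiff_lt_of_generateFrom_isSetRing (μ := m)
    (isSetAlgebra_finiteRectangles (X := X) (Y := Y)).isSetRing
    ⟨{Set.univ}, by simp, by simpa using isSetAlgebra_finiteRectangles.univ_mem, by simp⟩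
    generateFrom_finiteRectangles hPm (ε := ENNReal.ofReal (e / 2)) (by simpa using he)
  have hEm : MeasurableSet E := by
    rw [generateFrom_finiteRectangles]; exact MeasurableSpace.measurableSet_generateFrom hE
  have hDm : MeasurableSet (symmDiff E {p | 0 ≤ Z p}) := hEm.symmDiff hPm
  rw [hm, withDensity_apply _ hDm] at hEP
  have hEP' : ∫ p in symmDiff E {p | 0 ≤ Z p}, |Z p| ∂(μ.prod η) ≤ e / 2 := by
    rw [integral_eq_lintegral_of_nonneg_ae (Eventually.of_forall fun p => abs_nonneg _)
      hi.abs.1.restrict]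
    refine ENNReal.toReal_le_of_le_ofReal (by positivity) (le_of_eq_of_le ?_ hEP.le)
    simp only [Real.enorm_eq_ofReal_abs]
  have hgi : Integrable (fun p => (if p ∈ E then (1 : ℝ) else -1) * Z p) (μ.prod η) := by
    refine hi.mono ((Measurable.ite hEm measurable_const measurable_const).mul
      hZ).aestronglyMeasurable (Eventually.of_forall fun p => ?_)
    rw [norm_mul]
    split_ifs <;> simp
  have hDi : Integrable ((symmDiff E {p | 0 ≤ Z p}).indicator fun p => |Z p|) (μ.prod η) :=
    hi.abs.indicator hDm
  have hpt : ∀ p, |Z p| ≤ (if p ∈ E then (1 : ℝ) else -1) * Z p +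
      2 * (symmDiff E {p | 0 ≤ Z p}).indicator (fun p => |Z p|) p := by
    intro p
    by_cases h1 : p ∈ E <;> by_cases h2 : 0 ≤ Z p
    · simp [h1, h2, Set.mem_symmDiff, abs_of_nonneg]
    · have := abs_of_neg (not_le.1 h2)
      simp [h1, h2, Set.mem_symmDiff]; linarith
    · have := abs_of_nonneg h2
      simp [h1, h2, Set.mem_symmDiff]; linarith
    · have := abs_of_neg (not_le.1 h2)
      simp [h1, h2, Set.mem_symmDiff]; linarith
  calc ∫ p, |Z p| ∂(μ.prod η)
      ≤ ∫ p, ((if p ∈ E then (1 : ℝ) else -1) * Z p +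
        2 * (symmDiff E {p | 0 ≤ Z p}).indicator (fun p => |Z p|) p) ∂(μ.prod η) :=
        integral_mono hi.abs (hgi.add (hDi.const_mul 2)) hpt
    _ = ∫ p, (if p ∈ E then (1 : ℝ) else -1) * Z p ∂(μ.prod η) +
        2 * ∫ p in symmDiff E {p | 0 ≤ Z p}, |Z p| ∂(μ.prod η) := by
        rw [integral_add hgi (hDi.const_mul 2), integral_const_mul, integral_indicator hDm]
    _ ≤ γ * η.real Set.univ + e := by linarith [key E hE]

/-- A bounded integral operator `L¹(Y) → L¹(X)` with jointly measurable kernel `Z` satisfies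
`∫ |Z(x, y)| dx ≤ γ` for almost every `y`, where `γ` bounds the operator norm. -/
theorem ae_lintegral_kernel_le {μ : Measure X} {η : Measure Y} [SigmaFinite μ] [SigmaFinite η]
    {Z : X → Y → ℝ} (hZ : Measurable (fun p : X × Y => Z p.1 p.2)) {γ : ℝ}
    (h1 : ∀ f : Y → ℝ, Integrable f η → ∀ᵐ x ∂μ, Integrable (fun y => Z x y * f y) η)
    (h2 : ∀ f : Y → ℝ, Integrable f η → Integrable (fun x => ∫ y, Z x y * f y ∂η) μ)
    (h3 : ∀ f : Y → ℝ, Integrable f η →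
      ∫ x, |∫ y, Z x y * f y ∂η| ∂μ ≤ γ * ∫ y, |f y| ∂η) :
    ∀ᵐ y ∂η, ∫⁻ x, ‖Z x y‖ₑ ∂μ ≤ ENNReal.ofReal γ := by
  have hZe : Measurable (fun p : X × Y => ‖Z p.1 p.2‖ₑ) := hZ.enorm
  have hZe' : Measurable (fun p : Y × X => ‖Z p.2 p.1‖ₑ) := hZe.comp measurable_swap
  refine ae_le_of_forall_setLIntegral_le_of_sigmaFinite hZe'.lintegral_prod_right'
    fun B hB hBfin => ?_
  have : IsFiniteMeasure (η.restrict B) := ⟨by simpa using hBfin⟩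
  set Φ : X → ℝ≥0∞ := fun x => ∫⁻ y in B, ‖Z x y‖ₑ ∂η with hΦ
  have hΦm : Measurable Φ := hZe.lintegral_prod_right'
  have hind : ∀ C, MeasurableSet C → Integrable (C.indicator (1 : Y → ℝ)) (η.restrict B) :=
    fun C hC => (integrable_const (1 : ℝ)).indicator hC
  have hBC : ∀ C, MeasurableSet C → Integrable ((C ∩ B).indicator (1 : Y → ℝ)) η := by
    intro C hC
    rw [Set.inter_comm, ← Set.indicator_indicator, integrable_indicator_iff hB]
    exact hind C hC
  have hΦfin : ∀ᵐ x ∂μ, Φ x < ∞ := by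
    filter_upwards [h1 _ (hBC _ MeasurableSet.univ)] with x hx
    have : Integrable (fun y => Z x y) (η.restrict B) := by
      rw [← IntegrableOn, ← integrable_indicator_iff hB]
      refine hx.congr (Eventually.of_forall fun y => ?_)
      by_cases hy : y ∈ B <;> simp [hy]
    exact this.2
  -- A priori `Φ` is only finite a.e., so `Z` need not be known to be integrable on `X × B`. On `Sn
  -- n` it is, and the resulting bound does not involve `n`, so monotone convergence removes the
  -- truncation.
  set Sn : ℕ → Set X := fun n => {x | Φ x ≤ n} ∩ spanningSets μ n with hSn
  have hSm : ∀ n, MeasurableSet (Sn n) := fun n =>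
    (measurableSet_le hΦm measurable_const).inter (measurableSet_spanningSets μ n)
  have hmono : Monotone Sn := by
    intro a b hab x hx
    exact ⟨le_trans (show Φ x ≤ a from hx.1) (by exact_mod_cast hab),
      monotone_spanningSets μ hab hx.2⟩
  have hSnfin : ∀ n, μ (Sn n) < ∞ := fun n =>
    (measure_mono Set.inter_subset_right).trans_lt (measure_spanningSets_lt_top μ n)
  have hbound : ∀ n, ∫⁻ x in Sn n, Φ x ∂μ ≤ ENNReal.ofReal γ * η B := by
    intro n
    have hfin : ∫⁻ x in Sn n, Φ x ∂μ < ∞ := by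
      calc ∫⁻ x in Sn n, Φ x ∂μ ≤ ∫⁻ x in Sn n, (n : ℝ≥0∞) ∂μ :=
            setLIntegral_mono measurable_const fun x hx => hx.1
        _ = n * μ (Sn n) := by simp
        _ < ∞ := ENNReal.mul_lt_top (by simp) (hSnfin n)
    have hint : Integrable (fun p : X × Y => Z p.1 p.2)
        ((μ.restrict (Sn n)).prod (η.restrict B)) := by
      refine ⟨hZ.aestronglyMeasurable, ?_⟩
      rw [HasFiniteIntegral, lintegral_prod _ hZe.aemeasurable]
      exact hfin
    have := integral_abs_kernel_le hZ hint (γ := γ) (fun C hC => ?_)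
    · have e1 : ∫⁻ x in Sn n, Φ x ∂μ =
          ENNReal.ofReal (∫ p : X × Y, |Z p.1 p.2| ∂((μ.restrict (Sn n)).prod (η.restrict B))) := by
        rw [ofReal_integral_eq_lintegral_ofReal hint.abs
          (Eventually.of_forall fun _ => abs_nonneg _), lintegral_prod _
          hZ.abs.ennreal_ofReal.aemeasurable]
        simp only [hΦ, Real.enorm_eq_ofReal_abs]
      rw [e1]
      refine (ENNReal.ofReal_le_ofReal this).trans ?_
      rw [ENNReal.ofReal_mul' measureReal_nonneg, measureReal_def, Measure.restrict_apply_univ,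
        ENNReal.ofReal_toReal hBfin.ne]
    -- The set-wise hypothesis of `integral_abs_kernel_le` is the operator bound tested on the
    -- indicator of `C ∩ B`.
    · have e2 : ∀ x, ∫ y in C, Z x y ∂(η.restrict B) =
          ∫ y, Z x y * (C ∩ B).indicator (1 : Y → ℝ) y ∂η := by
        intro x
        rw [Measure.restrict_restrict hC, ← integral_indicator (hC.inter hB)]
        refine integral_congr_ae (Eventually.of_forall fun y => ?_)
        by_cases hy : y ∈ C ∩ B
        · simp only [Set.indicator_of_mem hy]; simp
        · simp only [Set.indicator_of_notMem hy]; simp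
      simp only [e2]
      calc _ ≤ ∫ x, |∫ y, Z x y * (C ∩ B).indicator (1 : Y → ℝ) y ∂η| ∂μ :=
            setIntegral_le_integral (h2 _ (hBC C hC)).abs
              (Eventually.of_forall fun _ => abs_nonneg _)
        _ ≤ _ := h3 _ (hBC C hC)
        _ = _ := by
            congr 1
            have : ∀ y, |(C ∩ B).indicator (1 : Y → ℝ) y| = (C ∩ B).indicator (1 : Y → ℝ) y :=
              fun y => abs_of_nonneg (Set.indicator_nonneg (by simp) _)
            simp only [this]
            rw [integral_indicator_one (hC.inter hB), measureReal_restrict_apply hC]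
  have hsup : ∫⁻ x, Φ x ∂μ ≤ ENNReal.ofReal γ * η B := by
    have hae : (⋃ n, Sn n) =ᵐ[μ] Set.univ := by
      rw [eventuallyEq_univ]
      filter_upwards [hΦfin] with x hx
      obtain ⟨n, hn⟩ := ENNReal.exists_nat_gt hx.ne
      have hx' : x ∈ ⋃ n, spanningSets μ n := by rw [iUnion_spanningSets]; trivial
      obtain ⟨m, hm⟩ := Set.mem_iUnion.1 hx'
      refine Set.mem_iUnion.2 ⟨max n m, ?_, monotone_spanningSets μ (le_max_right _ _) hm⟩
      exact hn.le.trans (by exact_mod_cast le_max_left _ _)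
    rw [← setLIntegral_univ, ← setLIntegral_congr hae,
      setLIntegral_iUnion_of_directed _ (hmono.directed_le)]
    exact iSup_le hbound
  rw [setLIntegral_const]
  rw [lintegral_lintegral_swap hZe'.aemeasurable]
  exact hsup

end finiteRectangles

/-! ### Appending one coordinate to a finite product. -/

theorem measurable_finSnoc {X : Type*} [MeasurableSpace X] {n : ℕ} :
    Measurable (fun q : (Fin n → X) × X =>
      (Fin.snoc (α := fun _ => X) q.1 q.2 : Fin (n + 1) → X)) := by
  refine measurable_pi_iff.2 fun i => ?_
  refine Fin.lastCases ?_ (fun j => ?_) i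
  · simp only [Fin.snoc_last]; fun_prop
  · simp only [Fin.snoc_castSucc]; fun_prop

theorem measurePreserving_finSnoc {X : Type*} [MeasurableSpace X] (m : Measure X) [SigmaFinite m]
    (n : ℕ) : MeasurePreserving
      (fun q : (Fin n → X) × X => (Fin.snoc (α := fun _ => X) q.1 q.2 : Fin (n + 1) → X))
      ((Measure.pi fun _ : Fin n => m).prod m) (Measure.pi fun _ : Fin (n + 1) => m) := by
  have h := ((measurePreserving_piFinSuccAbove (fun _ : Fin (n + 1) => m) (Fin.last n)).symm _).comp
    (Measure.measurePreserving_swap (μ := Measure.pi fun _ : Fin n => m) (ν := m))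
  convert h using 1
  funext q
  simp [MeasurableEquiv.piFinSuccAbove, Fin.insertNthEquiv]

theorem lintegral_pi_finSnoc {X : Type*} [MeasurableSpace X] (m : Measure X) [SigmaFinite m]
    {n : ℕ} {F : (Fin (n + 1) → X) → ℝ≥0∞} (hF : Measurable F) :
    ∫⁻ x, F x ∂(Measure.pi fun _ : Fin (n + 1) => m) =
      ∫⁻ x, ∫⁻ y, F (Fin.snoc (α := fun _ => X) x y) ∂m ∂(Measure.pi fun _ : Fin n => m) := by
  rw [← (measurePreserving_finSnoc m n).lintegral_comp hF]
  exact lintegral_prod _ (hF.comp measurable_finSnoc).aemeasurable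

/-! ### The trajectory law as an iterated composition of Markov kernels. -/

namespace POMDPClass

variable {Θ S A O : Type*} [MeasurableSpace S] [MeasurableSpace A] [MeasurableSpace O]
  {ν : Measure S} {ρ : Measure O}

theorem _root_.IsDensity.integrable {X : Type*} [MeasurableSpace X] {m : Measure X} {p : X → ℝ}
    (h : IsDensity m p) : Integrable p m := by
  by_contra hc
  have := h.integral_eq_one
  rw [integral_undef hc] at this
  exact zero_ne_one this

/-- The density of the state of step `k` given the states and observations of the steps
`0, …, k - 1` when `π` is executed. -/
noncomputable def priorDensity (M : POMDPClass Θ S A O ν ρ) (θ : Θ) (π : Policy A O) :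
    (k : ℕ) → (Fin k → S × O) → S → ℝ
  | 0, _ => M.init
  | k + 1, x => M.trans θ k (x (Fin.last k)).1 (π.act k fun j => (x j).2)

theorem measurable_priorDensity (M : POMDPClass Θ S A O ν ρ) (θ : Θ) (π : Policy A O) {k : ℕ}
    (hk : k ≤ M.H) :
    Measurable (fun q : (Fin k → S × O) × S => M.priorDensity θ π k q.1 q.2) := by
  cases k with
  | zero => exact M.init_density.measurable.comp measurable_snd
  | succ k =>
    have hg : Measurable (fun q : (Fin (k + 1) → S × O) × S => ((q.1 (Fin.last k)).1,
        π.act k (fun j => (q.1 j).2), q.2)) :=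
      Measurable.prodMk (by fun_prop) (Measurable.prodMk
        ((π.measurable_act k).comp (by fun_prop)) (by fun_prop))
    exact (M.trans_measurable θ k (by omega)).comp hg

theorem isDensity_priorDensity (M : POMDPClass Θ S A O ν ρ) (θ : Θ) (π : Policy A O) {k : ℕ}
    (hk : k ≤ M.H) (x : Fin k → S × O) : IsDensity ν (M.priorDensity θ π k x) := by
  cases k with
  | zero => exact M.init_density
  | succ k => exact M.trans_density θ k (by omega) _ _

theorem lintegral_mul_emit [SigmaFinite ρ] (M : POMDPClass Θ S A O ν ρ) (θ : Θ) {k : ℕ}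
    (hk : k ≤ M.H) {p : S → ℝ} (hp : IsDensity ν p) :
    ∫⁻ x, ENNReal.ofReal (p x.1 * M.emit θ k x.1 x.2) ∂(ν.prod ρ) = 1 := by
  rw [lintegral_prod]
  · have : ∀ s, ∫⁻ o, ENNReal.ofReal (p s * M.emit θ k s o) ∂ρ = ENNReal.ofReal (p s) := by
      intro s
      simp_rw [ENNReal.ofReal_mul (hp.nonneg s)]
      rw [lintegral_const_mul' _ _ ENNReal.ofReal_ne_top, (M.emit_density θ k hk s).lintegral,
        mul_one]
    simp_rw [this]
    exact hp.lintegral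
  · exact ((hp.measurable.comp measurable_fst).mul
      (M.emit_measurable θ k hk)).ennreal_ofReal.aemeasurable

theorem measurable_stepDensity (M : POMDPClass Θ S A O ν ρ) (θ : Θ) (π : Policy A O) {k : ℕ}
    (hk : k ≤ M.H) : Measurable (fun q : (Fin k → S × O) × (S × O) =>
      M.priorDensity θ π k q.1 q.2.1 * M.emit θ k q.2.1 q.2.2) := by
  have h1 := (M.measurable_priorDensity θ π hk).comp
    (show Measurable fun q : (Fin k → S × O) × (S × O) => (q.1, q.2.1) by fun_prop)
  have h2 := (M.emit_measurable θ k hk).comp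
    (show Measurable fun q : (Fin k → S × O) × (S × O) => q.2 by fun_prop)
  exact h1.mul h2

variable [SigmaFinite ν] [SigmaFinite ρ]

/-- The conditional law of the state and the observation of step `k` given the states and
observations of the earlier steps. -/
noncomputable def stepKernel (M : POMDPClass Θ S A O ν ρ) (θ : Θ) (π : Policy A O) (k : ℕ) :
    Kernel (Fin k → S × O) (S × O) :=
  (Kernel.const _ (ν.prod ρ)).withDensity
    -- Written as a coercion from `ℝ≥0`, the density is visibly finite, so s-finiteness is found by
    -- instance search for every `k`, even beyond the horizon.
    fun x p => (Real.toNNReal (M.priorDensity θ π k x p.1 * M.emit θ k p.1 p.2) : ℝ≥0∞)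

instance (M : POMDPClass Θ S A O ν ρ) (θ : Θ) (π : Policy A O) (k : ℕ) :
    IsSFiniteKernel (M.stepKernel θ π k) := by
  unfold stepKernel; infer_instance

theorem stepKernel_apply (M : POMDPClass Θ S A O ν ρ) (θ : Θ) (π : Policy A O) {k : ℕ}
    (hk : k ≤ M.H) (x : Fin k → S × O) : M.stepKernel θ π k x =
      (ν.prod ρ).withDensity
        fun p => ENNReal.ofReal (M.priorDensity θ π k x p.1 * M.emit θ k p.1 p.2) := by
  unfold stepKernel
  rw [Kernel.withDensity_apply]
  · rfl
  · exact (M.measurable_stepDensity θ π hk).ennreal_ofReal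

theorem isMarkovKernel_stepKernel (M : POMDPClass Θ S A O ν ρ) (θ : Θ) (π : Policy A O) {k : ℕ}
    (hk : k ≤ M.H) : IsMarkovKernel (M.stepKernel θ π k) := by
  refine ⟨fun x => ⟨?_⟩⟩
  rw [M.stepKernel_apply θ π hk, withDensity_apply _ MeasurableSet.univ, Measure.restrict_univ]
  exact M.lintegral_mul_emit θ hk (M.isDensity_priorDensity θ π hk x)

theorem integral_stepKernel (M : POMDPClass Θ S A O ν ρ) (θ : Θ) (π : Policy A O) {k : ℕ}
    (hk : k ≤ M.H) (x : Fin k → S × O) (g : S × O → ℝ) :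
    ∫ p, g p ∂(M.stepKernel θ π k x) =
      ∫ p : S × O, g p * (M.priorDensity θ π k x p.1 * M.emit θ k p.1 p.2) ∂(ν.prod ρ) := by
  rw [M.stepKernel_apply θ π hk, integral_withDensity_eq_integral_toReal_smul₀]
  · refine integral_congr_ae (Eventually.of_forall fun p => ?_)
    have : 0 ≤ M.priorDensity θ π k x p.1 * M.emit θ k p.1 p.2 :=
      mul_nonneg ((M.isDensity_priorDensity θ π hk x).nonneg _)
        ((M.emit_density θ k hk _).nonneg _)
    simp only [smul_eq_mul, ENNReal.toReal_ofReal this, mul_comm]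
  · exact ((M.measurable_stepDensity θ π hk).comp
      measurable_prodMk_left).ennreal_ofReal.aemeasurable
  · exact Eventually.of_forall fun _ => ENNReal.ofReal_lt_top

/-- The law of the states and observations of the steps `0, …, k - 1`. -/
noncomputable def prefixLaw (M : POMDPClass Θ S A O ν ρ) (θ : Θ) (π : Policy A O) :
    (k : ℕ) → Measure (Fin k → S × O)
  | 0 => Measure.pi fun _ => ν.prod ρ
  | k + 1 => ((M.prefixLaw θ π k) ⊗ₘ (M.stepKernel θ π k)).map
      fun q => Fin.snoc (α := fun _ => S × O) q.1 q.2

theorem isProbabilityMeasure_prefixLaw (M : POMDPClass Θ S A O ν ρ) (θ : Θ) (π : Policy A O)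
    {k : ℕ} (hk : k ≤ M.H + 1) : IsProbabilityMeasure (M.prefixLaw θ π k) := by
  induction k with
  | zero => rw [prefixLaw, Measure.pi_of_empty]; infer_instance
  | succ k ih =>
    have := ih (by omega)
    have := M.isMarkovKernel_stepKernel θ π (k := k) (by omega)
    exact Measure.isProbabilityMeasure_map measurable_finSnoc.aemeasurable

theorem lintegral_prefixLaw_succ (M : POMDPClass Θ S A O ν ρ) (θ : Θ) (π : Policy A O)
    {k : ℕ} (hk : k ≤ M.H) {F : (Fin (k + 1) → S × O) → ℝ≥0∞} (hF : Measurable F) :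
    ∫⁻ ω, F ω ∂(M.prefixLaw θ π (k + 1)) = ∫⁻ x, ∫⁻ p : S × O,
      ENNReal.ofReal (M.priorDensity θ π k x p.1 * M.emit θ k p.1 p.2) *
        F (Fin.snoc (α := fun _ => S × O) x p) ∂(ν.prod ρ) ∂(M.prefixLaw θ π k) := by
  have := M.isProbabilityMeasure_prefixLaw θ π (k := k) (by omega)
  rw [prefixLaw, lintegral_map hF measurable_finSnoc,
    Measure.lintegral_compProd (f := fun q => F (Fin.snoc (α := fun _ => S × O) q.1 q.2))
      (hF.comp measurable_finSnoc)]
  refine lintegral_congr fun x => ?_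
  rw [M.stepKernel_apply θ π hk, lintegral_withDensity_eq_lintegral_mul]
  · rfl
  · exact ((M.measurable_stepDensity θ π hk).comp measurable_prodMk_left).ennreal_ofReal
  · exact (hF.comp measurable_finSnoc).comp measurable_prodMk_left

theorem integral_prefixLaw_succ (M : POMDPClass Θ S A O ν ρ) (θ : Θ) (π : Policy A O)
    {k : ℕ} (hk : k ≤ M.H) {F : (Fin (k + 1) → S × O) → ℝ}
    (hFi : Integrable F (M.prefixLaw θ π (k + 1))) :
    ∫ ω, F ω ∂(M.prefixLaw θ π (k + 1)) = ∫ x, ∫ p : S × O,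
      F (Fin.snoc (α := fun _ => S × O) x p) *
        (M.priorDensity θ π k x p.1 * M.emit θ k p.1 p.2) ∂(ν.prod ρ) ∂(M.prefixLaw θ π k) := by
  have := M.isProbabilityMeasure_prefixLaw θ π (k := k) (by omega)
  rw [prefixLaw] at hFi ⊢
  rw [integral_map measurable_finSnoc.aemeasurable hFi.1, Measure.integral_compProd
    (f := fun q => F (Fin.snoc (α := fun _ => S × O) q.1 q.2))
    ((integrable_map_measure hFi.1 measurable_finSnoc.aemeasurable).1 hFi)]
  exact integral_congr_ae (Eventually.of_forall fun x => M.integral_stepKernel θ π hk x _)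

/-- The trajectory density is multiplicative in the steps (`trajDensity_snoc`), and each new factor
is exactly the density of the step kernel. -/
theorem prefixLaw_eq_withDensity (M : POMDPClass Θ S A O ν ρ) (θ : Θ) (π : Policy A O)
    {n : ℕ} (hn : n ≤ M.H) : M.prefixLaw θ π (n + 1) =
      (Measure.pi fun _ : Fin (n + 1) => ν.prod ρ).withDensity
        fun ω => ENNReal.ofReal (M.trajDensity θ π n ω) := by
  induction n with
  | zero =>
    refine Measure.ext_of_lintegral _ fun F hF => ?_
    have hd := (M.measurable_trajDensity θ π 0 hn).ennreal_ofReal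
    rw [M.lintegral_prefixLaw_succ θ π hn hF, lintegral_withDensity_eq_lintegral_mul _ hd hF,
      ← (measurePreserving_finSnoc (ν.prod ρ) 0).lintegral_comp (hd.mul hF), lintegral_prod]
    · refine lintegral_congr fun x => lintegral_congr fun p => ?_
      have h0 : (Fin.snoc (α := fun _ => S × O) x p : Fin 1 → S × O) 0 = p :=
        Fin.snoc_last (α := fun _ => S × O) p x
      simp [trajDensity, h0, priorDensity]
    · exact ((hd.mul hF).comp measurable_finSnoc).aemeasurable
  | succ n ih =>
    refine Measure.ext_of_lintegral _ fun F hF => ?_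
    have hd := (M.measurable_trajDensity θ π (n + 1) hn).ennreal_ofReal
    have hG : Measurable fun q : (Fin (n + 1) → S × O) × (S × O) =>
      ENNReal.ofReal (M.priorDensity θ π (n + 1) q.1 q.2.1 * M.emit θ (n + 1) q.2.1 q.2.2) *
        F (Fin.snoc (α := fun _ => S × O) q.1 q.2) :=
      (M.measurable_stepDensity θ π hn).ennreal_ofReal.mul (hF.comp measurable_finSnoc)
    rw [M.lintegral_prefixLaw_succ θ π hn hF, lintegral_withDensity_eq_lintegral_mul _ hd hF,
      ← (measurePreserving_finSnoc (ν.prod ρ) (n + 1)).lintegral_comp (hd.mul hF), lintegral_prod,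
      ih (by omega), lintegral_withDensity_eq_lintegral_mul _
        (M.measurable_trajDensity θ π n (by omega)).ennreal_ofReal hG.lintegral_prod_right']
    · refine lintegral_congr fun x => ?_
      rw [Pi.mul_apply, ← lintegral_const_mul' _ _ ENNReal.ofReal_ne_top]
      refine lintegral_congr fun p => ?_
      rw [Pi.mul_apply, trajDensity_snoc,
        ENNReal.ofReal_mul (M.trajDensity_nonneg θ π n (by omega) x), mul_assoc]
      rfl
    · exact ((hd.mul hF).comp measurable_finSnoc).aemeasurable

theorem law_eq_prefixLaw (M : POMDPClass Θ S A O ν ρ) (θ : Θ) (π : Policy A O) :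
    M.law θ π = M.prefixLaw θ π (M.H + 1) :=
  (M.prefixLaw_eq_withDensity θ π le_rfl).symm

/-- The step kernels are Markov, so forgetting the last step is the first marginal of a composition
product. -/
theorem map_prefixLaw (M : POMDPClass Θ S A O ν ρ) (θ : Θ) (π : Policy A O)
    {j k : ℕ} (hjk : j ≤ k) (hk : k ≤ M.H + 1) :
    (M.prefixLaw θ π k).map (fun ω i => ω (Fin.castLE hjk i)) = M.prefixLaw θ π j := by
  induction k with
  | zero =>
    obtain rfl : j = 0 := by omega
    exact Measure.map_id
  | succ k ih =>
    rcases Nat.lt_or_ge k j with h | h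
    · obtain rfl : j = k + 1 := by omega
      exact Measure.map_id
    · have := M.isProbabilityMeasure_prefixLaw θ π (k := k) (by omega)
      have := M.isMarkovKernel_stepKernel θ π (k := k) (by omega)
      rw [← ih h (by omega), prefixLaw, Measure.map_map (by fun_prop) measurable_finSnoc]
      have hfst : ((M.prefixLaw θ π k) ⊗ₘ (M.stepKernel θ π k)).map Prod.fst =
        M.prefixLaw θ π k := Measure.fst_compProd _ _
      conv_rhs => rw [← hfst]
      rw [Measure.map_map (by fun_prop) measurable_fst]
      congr 1
      funext q i
      exact Fin.snoc_castSucc (α := fun _ => S × O) q.2 q.1 (Fin.castLE h i)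

theorem map_law (M : POMDPClass Θ S A O ν ρ) (θ : Θ) (π : Policy A O)
    {j : ℕ} (hj : j ≤ M.H + 1) :
    (M.law θ π).map (fun ω i => ω (Fin.castLE hj i)) = M.prefixLaw θ π j := by
  rw [law_eq_prefixLaw]
  exact M.map_prefixLaw θ π hj le_rfl

end POMDPClass

/-! ### Histories generated by a deterministic policy. -/

namespace Policy

variable {S A O : Type*} [MeasurableSpace A] [MeasurableSpace O]

/-- The actions that `π` takes along a sequence of observations. -/
def acts (π : Policy A O) (k : ℕ) (o : Fin k → O) : Fin k → A :=
  fun j => π.act j fun i : Fin (j + 1) => o (Fin.castLE (by omega) i)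

/-- The full history that `π` produces from a sequence of observations. -/
def histOf (π : Policy A O) (k : ℕ) (o : Fin (k + 1) → O) : Hist A O k :=
  (o, π.acts k fun i => o i.castSucc)

theorem measurable_acts (π : Policy A O) (k : ℕ) : Measurable (π.acts k) :=
  measurable_pi_iff.2 fun j => (π.measurable_act j).comp (by fun_prop)

theorem measurable_histOf (π : Policy A O) (k : ℕ) : Measurable (π.histOf k) :=
  measurable_id.prodMk ((π.measurable_acts k).comp (by fun_prop))

theorem hist_eq_histOf (π : Policy A O) {n k : ℕ} (hk : k ≤ n) (ω : Fin (n + 1) → S × O) :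
    π.hist k hk ω = π.histOf k fun i => (ω (Fin.castLE (by omega) i)).2 := rfl

/-- The actions of the steps before `k` do not see the observation of step `k`. This is what lets
the last observation be integrated out, or replaced, with the actions held fixed. -/
theorem histOf_snoc_eq (π : Policy A O) {k : ℕ} (o : Fin k → O) (o' : O) :
    π.histOf k (Fin.snoc (α := fun _ => O) o o') =
      (Fin.snoc (α := fun _ => O) o o', π.acts k o) := by
  simp [histOf, Fin.snoc_castSucc (α := fun _ => O)]

theorem acts_succ (π : Policy A O) {k : ℕ} (o : Fin (k + 1) → O) :
    π.acts (k + 1) o = Fin.snoc (α := fun _ => A) (π.acts k fun i => o i.castSucc) (π.act k o) := by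
  funext j
  refine Fin.lastCases ?_ (fun i => ?_) j
  · rw [Fin.snoc_last]; rfl
  · rw [Fin.snoc_castSucc]; rfl

theorem histOf_snoc (π : Policy A O) {k : ℕ} (o : Fin (k + 1) → O) (o' : O) :
    π.histOf (k + 1) (Fin.snoc (α := fun _ => O) o o') = (π.histOf k o).extend (π.act k o) o' := by
  rw [histOf_snoc_eq, acts_succ]; rfl

end Policy

theorem snd_finSnoc {S O : Type*} {k : ℕ} (x : Fin k → S × O) (p : S × O) :
    (fun i => ((Fin.snoc (α := fun _ => S × O) x p : Fin (k + 1) → S × O) i).2) =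
      (Fin.snoc (α := fun _ => O) (fun i => (x i).2) p.2 : Fin (k + 1) → O) := by
  funext j
  refine Fin.lastCases ?_ (fun i => ?_) j <;> simp

/-! ### The forward density of the observations and the current state. -/

namespace POMDPClass

variable {Θ S A O : Type*} [MeasurableSpace S] [MeasurableSpace A] [MeasurableSpace O]
  {ν : Measure S} {ρ : Measure O}

theorem forward_extend (M : POMDPClass Θ S A O ν ρ) (θ : Θ) {k : ℕ} (τ : Hist A O k) (a : A) (o : O)
    (s' : S) : M.forward θ (k + 1) (τ.extend a o) s' =
      M.emit θ (k + 1) s' o * ∫ s, M.trans θ k s a s' * M.forward θ k τ s ∂ν := by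
  simp [forward, Hist.extend]

theorem forward_nonneg (M : POMDPClass Θ S A O ν ρ) (θ : Θ) {k : ℕ} (hk : k ≤ M.H) (τ : Hist A O k)
    (s : S) : 0 ≤ M.forward θ k τ s := by
  induction k generalizing s with
  | zero => exact mul_nonneg ((M.emit_density θ 0 hk s).nonneg _) (M.init_density.nonneg _)
  | succ k ih =>
    exact mul_nonneg ((M.emit_density θ _ hk s).nonneg _) (integral_nonneg fun s' =>
      mul_nonneg ((M.trans_density θ k (by omega) _ _).nonneg _) (ih (by omega) _ _))

variable [SigmaFinite ν]

theorem measurable_forward (M : POMDPClass Θ S A O ν ρ) (θ : Θ) {k : ℕ} (hk : k ≤ M.H) :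
    Measurable (fun q : Hist A O k × S => M.forward θ k q.1 q.2) := by
  induction k with
  | zero =>
    exact ((M.emit_measurable θ 0 hk).comp (show Measurable fun q : Hist A O 0 × S =>
      (q.2, q.1.1 0) by fun_prop)).mul (M.init_density.measurable.comp measurable_snd)
  | succ k ih =>
    have h1 := (M.emit_measurable θ (k + 1) hk).comp (show Measurable fun q : Hist A O (k + 1) × S =>
      (q.2, q.1.1 (Fin.last (k + 1))) by fun_prop)
    have h2 := (M.trans_measurable θ k (by omega)).comp
      (show Measurable fun q : (Hist A O (k + 1) × S) × S =>
        (q.2, q.1.1.2 (Fin.last k), q.1.2) by fun_prop)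
    have h3 := (ih (by omega)).comp (show Measurable fun q : (Hist A O (k + 1) × S) × S =>
        ((((fun i => q.1.1.1 i.castSucc, fun i => q.1.1.2 i.castSucc) : Hist A O k), q.2) :
          Hist A O k × S) by fun_prop)
    exact h1.mul (h2.mul h3).stronglyMeasurable.integral_prod_right'.measurable

variable [SigmaFinite ρ]

/-- Induction on `k`: integrating the old state out of (forward density) × (transition) × (emission)
by Tonelli is the recursion that defines `forward`. -/
theorem lintegral_forward (M : POMDPClass Θ S A O ν ρ) (θ : Θ) (π : Policy A O) {k : ℕ}
    (hk : k ≤ M.H) {F : (Fin (k + 1) → O) × S → ℝ≥0∞} (hF : Measurable F) :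
    ∫⁻ x, F (fun i => (x i).2, (x (Fin.last k)).1) ∂(M.prefixLaw θ π (k + 1)) =
      ∫⁻ o, ∫⁻ s, ENNReal.ofReal (M.forward θ k (π.histOf k o) s) * F (o, s) ∂ν
        ∂(Measure.pi fun _ : Fin (k + 1) => ρ) := by
  have hfwd : ∀ {k}, k ≤ M.H → Measurable fun q : (Fin (k + 1) → O) × S =>
      ENNReal.ofReal (M.forward θ k (π.histOf k q.1) q.2) := fun {k} hk =>
    ((M.measurable_forward θ hk).comp
      (((π.measurable_histOf k).comp measurable_fst).prodMk measurable_snd)).ennreal_ofReal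
  induction k with
  | zero =>
    have hR : Measurable fun o : Fin 1 → O =>
        ∫⁻ s, ENNReal.ofReal (M.forward θ 0 (π.histOf 0 o) s) * F (o, s) ∂ν :=
      ((hfwd hk).mul hF).lintegral_prod_right'
    have hx : ∀ (x : Fin 0 → O) (o : O), (Fin.snoc (α := fun _ => O) x o : Fin 1 → O) 0 = o :=
      fun x o => Fin.snoc_last (α := fun _ => O) o x
    have hFω : Measurable fun x : Fin (0 + 1) → S × O =>
        F (fun i => (x i).2, (x (Fin.last (0))).1) := hF.comp (by fun_prop)
    rw [M.lintegral_prefixLaw_succ θ π hk hFω, lintegral_pi_finSnoc ρ hR, prefixLaw, Measure.pi_of_empty,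
      Measure.pi_of_empty, lintegral_dirac, lintegral_dirac, lintegral_prod_symm]
    · refine lintegral_congr fun o => lintegral_congr fun s => ?_
      rw [snd_finSnoc, Fin.snoc_last]
      simp only [forward, priorDensity, Policy.histOf, hx]
      rw [mul_comm (M.init s)]
      congr 3
    · refine Measurable.aemeasurable (Measurable.mul ?_ ?_)
      · exact ((M.measurable_stepDensity θ π hk).comp measurable_prodMk_left).ennreal_ofReal
      · exact (hFω.comp measurable_finSnoc).comp measurable_prodMk_left
  | succ k ih =>
    have hk' : k ≤ M.H := by omega
    have hR : Measurable fun o : Fin (k + 2) → O =>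
        ∫⁻ s, ENNReal.ofReal (M.forward θ (k + 1) (π.histOf (k + 1) o) s) * F (o, s) ∂ν :=
      ((hfwd hk).mul hF).lintegral_prod_right'
    have hd : Measurable fun q : ((Fin (k + 1) → O) × S) × (S × O) =>
        M.trans θ k q.1.2 (π.act k q.1.1) q.2.1 * M.emit θ (k + 1) q.2.1 q.2.2 :=
      ((M.trans_measurable θ k (by omega)).comp
        ((by fun_prop : Measurable fun q : ((Fin (k + 1) → O) × S) × (S × O) => q.1.2).prodMk
          (((π.measurable_act k).comp (by fun_prop)).prodMk (by fun_prop)))).mul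
      ((M.emit_measurable θ (k + 1) hk).comp (by fun_prop))
    have hF' : Measurable fun q : ((Fin (k + 1) → O) × S) × (S × O) =>
        F (Fin.snoc (α := fun _ => O) q.1.1 q.2.2, q.2.1) :=
      hF.comp ((measurable_finSnoc.comp (by fun_prop : Measurable
        fun q : ((Fin (k + 1) → O) × S) × (S × O) => (q.1.1, q.2.2))).prodMk (by fun_prop))
    have hG : Measurable fun q : (Fin (k + 1) → O) × S => ∫⁻ p : S × O,
        ENNReal.ofReal (M.trans θ k q.2 (π.act k q.1) p.1 * M.emit θ (k + 1) p.1 p.2) *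
          F (Fin.snoc (α := fun _ => O) q.1 p.2, p.1) ∂(ν.prod ρ) :=
      (hd.ennreal_ofReal.mul hF').lintegral_prod_right'
    have hFω : Measurable fun x : Fin (k + 1 + 1) → S × O =>
        F (fun i => (x i).2, (x (Fin.last (k + 1))).1) := hF.comp (by fun_prop)
    rw [M.lintegral_prefixLaw_succ θ π hk hFω, lintegral_pi_finSnoc ρ hR]
    simp only [snd_finSnoc, Fin.snoc_last]
    refine (ih hk' hG).trans (lintegral_congr_ae ?_)
    -- `forward` contains a Bochner integral, which is `0` when it diverges, so it matches the
    -- Lebesgue integral only where the latter is finite. The induction hypothesis with `F = 1` says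
    -- that the total mass is `1`, hence the mass at `o` is finite for a.e. `o`; `hfin` transfers
    -- this to a.e. new state.
    have hmass : ∀ᵐ o ∂(Measure.pi fun _ : Fin (k + 1) => ρ),
        ∫⁻ s, ENNReal.ofReal (M.forward θ k (π.histOf k o) s) ∂ν < ∞ := by
      have h1 := ih hk' (F := 1) measurable_one
      have := M.isProbabilityMeasure_prefixLaw θ π (k := k + 1) (by omega)
      simp only [Pi.one_apply, mul_one, lintegral_one, measure_univ] at h1
      exact ae_lt_top (hfwd hk').lintegral_prod_right' (by rw [← h1]; simp)
    filter_upwards [hmass] with o ho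
    have hφ : Measurable fun s => M.forward θ k (π.histOf k o) s :=
      (M.measurable_forward θ hk').comp measurable_prodMk_left
    have htr : Measurable fun q : S × S => M.trans θ k q.1 (π.act k o) q.2 :=
      (M.trans_measurable θ k (by omega)).comp
        (by fun_prop : Measurable fun q : S × S => (q.1, π.act k o, q.2))
    have hem : Measurable fun p : S × O => M.emit θ (k + 1) p.1 p.2 := M.emit_measurable θ _ hk
    have hFo : Measurable fun p : S × O => F (Fin.snoc (α := fun _ => O) o p.2, p.1) :=
      hF.comp ((measurable_finSnoc.comp (by fun_prop : Measurable
        fun p : S × O => (o, p.2))).prodMk (by fun_prop))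
    have hprod : Measurable fun q : S × S =>
        ENNReal.ofReal (M.trans θ k q.1 (π.act k o) q.2 * M.forward θ k (π.histOf k o) q.1) :=
      (htr.mul (hφ.comp measurable_fst)).ennreal_ofReal
    have hfin : ∀ᵐ s' ∂ν, ∫⁻ s, ENNReal.ofReal
        (M.trans θ k s (π.act k o) s' * M.forward θ k (π.histOf k o) s) ∂ν < ∞ := by
      refine ae_lt_top hprod.lintegral_prod_left' ?_
      rw [← lintegral_lintegral_swap hprod.aemeasurable]
      refine ne_of_lt (lt_of_le_of_lt (le_of_eq ?_) ho)
      refine lintegral_congr fun s => ?_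
      simp only [ENNReal.ofReal_mul ((M.trans_density θ k (by omega) _ _).nonneg _)]
      rw [lintegral_mul_const' _ _ ENNReal.ofReal_ne_top,
        (M.trans_density θ k (by omega) _ _).lintegral, one_mul]
    calc ∫⁻ s, ENNReal.ofReal (M.forward θ k (π.histOf k o) s) * ∫⁻ p : S × O,
          ENNReal.ofReal (M.trans θ k s (π.act k o) p.1 * M.emit θ (k + 1) p.1 p.2) *
            F (Fin.snoc (α := fun _ => O) o p.2, p.1) ∂(ν.prod ρ) ∂ν
        = ∫⁻ s, ∫⁻ p : S × O, ENNReal.ofReal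
            (M.trans θ k s (π.act k o) p.1 * M.forward θ k (π.histOf k o) s) *
            (ENNReal.ofReal (M.emit θ (k + 1) p.1 p.2) *
            F (Fin.snoc (α := fun _ => O) o p.2, p.1)) ∂(ν.prod ρ) ∂ν := by
          refine lintegral_congr fun s => ?_
          rw [← lintegral_const_mul' _ _ ENNReal.ofReal_ne_top]
          refine lintegral_congr fun p => ?_
          rw [ENNReal.ofReal_mul ((M.trans_density θ k (by omega) _ _).nonneg _),
            ENNReal.ofReal_mul ((M.trans_density θ k (by omega) _ _).nonneg _)]
          ring
      _ = ∫⁻ p : S × O, (∫⁻ s, ENNReal.ofReal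
            (M.trans θ k s (π.act k o) p.1 * M.forward θ k (π.histOf k o) s) ∂ν) *
            (ENNReal.ofReal (M.emit θ (k + 1) p.1 p.2) *
            F (Fin.snoc (α := fun _ => O) o p.2, p.1)) ∂(ν.prod ρ) := by
          rw [lintegral_lintegral_swap]
          · refine lintegral_congr fun p => ?_
            rw [lintegral_mul_const]
            exact hprod.comp measurable_prodMk_right
          · refine Measurable.aemeasurable (Measurable.mul ?_ ?_)
            · exact hprod.comp (by fun_prop : Measurable fun q : S × (S × O) => (q.1, q.2.1))
            · exact (hem.ennreal_ofReal.mul hFo).comp measurable_snd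
      _ = ∫⁻ o', ∫⁻ s', (∫⁻ s, ENNReal.ofReal
            (M.trans θ k s (π.act k o) s' * M.forward θ k (π.histOf k o) s) ∂ν) *
            (ENNReal.ofReal (M.emit θ (k + 1) s' o') *
            F (Fin.snoc (α := fun _ => O) o o', s')) ∂ν ∂ρ := by
          rw [lintegral_prod_symm]
          exact ((hprod.lintegral_prod_left'.comp measurable_fst).mul
            (hem.ennreal_ofReal.mul hFo)).aemeasurable
      _ = _ := by
          refine lintegral_congr fun o' => lintegral_congr_ae ?_
          filter_upwards [hfin] with s' hs'
          have hint : Integrable (fun s =>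
              M.trans θ k s (π.act k o) s' * M.forward θ k (π.histOf k o) s) ν := by
            refine ⟨((htr.comp measurable_prodMk_right).mul hφ).aestronglyMeasurable, ?_⟩
            rwa [hasFiniteIntegral_iff_ofReal]
            exact Eventually.of_forall fun s => mul_nonneg
              ((M.trans_density θ k (by omega) _ _).nonneg _) (M.forward_nonneg θ hk' _ _)
          rw [Policy.histOf_snoc, forward_extend,
            ENNReal.ofReal_mul ((M.emit_density θ _ hk _).nonneg _),
            ofReal_integral_eq_lintegral_ofReal hint]
          · ring
          · exact Eventually.of_forall fun s => mul_nonneg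
              ((M.trans_density θ k (by omega) _ _).nonneg _) (M.forward_nonneg θ hk' _ _)

/-- The joint law of the observations of the steps `0, …, k` and the state of step `k` has the
forward density. -/
theorem map_prefixLaw_eq_forward (M : POMDPClass Θ S A O ν ρ) (θ : Θ) (π : Policy A O) {k : ℕ}
    (hk : k ≤ M.H) :
    (M.prefixLaw θ π (k + 1)).map (fun x => ((fun i => (x i).2 : Fin (k + 1) → O),
      (x (Fin.last k)).1)) = ((Measure.pi fun _ : Fin (k + 1) => ρ).prod ν).withDensity
        fun q => ENNReal.ofReal (M.forward θ k (π.histOf k q.1) q.2) := by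
  have hfwd : Measurable fun q : (Fin (k + 1) → O) × S =>
      ENNReal.ofReal (M.forward θ k (π.histOf k q.1) q.2) :=
    ((M.measurable_forward θ hk).comp
      (((π.measurable_histOf k).comp measurable_fst).prodMk measurable_snd)).ennreal_ofReal
  refine Measure.ext_of_lintegral _ fun F hF => ?_
  rw [lintegral_map hF (by fun_prop), M.lintegral_forward θ π hk hF,
    lintegral_withDensity_eq_lintegral_mul _ hfwd hF, lintegral_prod _ (hfwd.mul hF).aemeasurable]
  rfl

theorem integrable_forward (M : POMDPClass Θ S A O ν ρ) (θ : Θ) (π : Policy A O) {k : ℕ}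
    (hk : k ≤ M.H) : Integrable (fun q : (Fin (k + 1) → O) × S =>
      M.forward θ k (π.histOf k q.1) q.2) ((Measure.pi fun _ : Fin (k + 1) => ρ).prod ν) := by
  have hfwd : Measurable fun q : (Fin (k + 1) → O) × S =>
      M.forward θ k (π.histOf k q.1) q.2 :=
    ((M.measurable_forward θ hk).comp
      (((π.measurable_histOf k).comp measurable_fst).prodMk measurable_snd))
  refine ⟨hfwd.aestronglyMeasurable, ?_⟩
  rw [hasFiniteIntegral_iff_ofReal (Eventually.of_forall fun q => M.forward_nonneg θ hk _ _),
    lintegral_prod _ hfwd.ennreal_ofReal.aemeasurable]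
  have h1 := M.lintegral_forward θ π hk (F := 1) measurable_one
  have := M.isProbabilityMeasure_prefixLaw θ π (k := k + 1) (by omega)
  simp only [Pi.one_apply, mul_one, lintegral_one, measure_univ] at h1
  rw [← h1]
  exact ENNReal.one_lt_top

theorem integral_forward (M : POMDPClass Θ S A O ν ρ) (θ : Θ) (π : Policy A O) {k : ℕ}
    (hk : k ≤ M.H) {F : (Fin (k + 1) → O) × S → ℝ} (hF : Measurable F) {C : ℝ}
    (hC : ∀ q, |F q| ≤ C) :
    ∫ x, F (fun i => (x i).2, (x (Fin.last k)).1) ∂(M.prefixLaw θ π (k + 1)) =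
      ∫ o, ∫ s, F (o, s) * M.forward θ k (π.histOf k o) s ∂ν
        ∂(Measure.pi fun _ : Fin (k + 1) => ρ) := by
  have hfi := M.integrable_forward θ π hk
  rw [← integral_map (φ := fun x : Fin (k + 1) → S × O => ((fun i => (x i).2 : Fin (k + 1) → O),
    (x (Fin.last k)).1)) (by fun_prop) hF.aestronglyMeasurable, M.map_prefixLaw_eq_forward θ π hk,
    integral_withDensity_eq_integral_toReal_smul₀]
  · rw [← integral_prod (f := fun q : (Fin (k + 1) → O) × S =>
      F q * M.forward θ k (π.histOf k q.1) q.2)]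
    · refine integral_congr_ae (Eventually.of_forall fun q => ?_)
      simp only [smul_eq_mul, ENNReal.toReal_ofReal (M.forward_nonneg θ hk _ _), mul_comm]
    · exact hfi.bdd_mul (c := C) hF.aestronglyMeasurable (Eventually.of_forall hC)
  · exact hfi.1.aemeasurable.ennreal_ofReal
  · exact Eventually.of_forall fun _ => ENNReal.ofReal_lt_top

/-- This makes an L^∞ class on histories meaningful along trajectories: null sets of the reference
measure are not seen under any policy. -/
theorem map_obs_absolutelyContinuous (M : POMDPClass Θ S A O ν ρ) (θ : Θ) (π : Policy A O) {k : ℕ}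
    (hk : k ≤ M.H) :
    (M.prefixLaw θ π (k + 1)).map (fun x => (fun i => (x i).2 : Fin (k + 1) → O)) ≪
      Measure.pi fun _ : Fin (k + 1) => ρ := by
  have h : (M.prefixLaw θ π (k + 1)).map (fun x => (fun i => (x i).2 : Fin (k + 1) → O)) =
      ((M.prefixLaw θ π (k + 1)).map (fun x => ((fun i => (x i).2 : Fin (k + 1) → O),
        (x (Fin.last k)).1))).map Prod.fst := by
    rw [Measure.map_map measurable_fst (by fun_prop)]; rfl
  rw [h, M.map_prefixLaw_eq_forward θ π hk]
  exact ((withDensity_absolutelyContinuous _ _).map measurable_fst).trans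
    Measure.quasiMeasurePreserving_fst.absolutelyContinuous

end POMDPClass

/-! ### Fubini for density kernels. -/

section Density

variable {X Y : Type*} [MeasurableSpace X] [MeasurableSpace Y] {μ : Measure X} {η : Measure Y}

/-- The weight `p` is allowed to be signed because it will also be a section of the bridge function.
-/
theorem integrable_mul_kernel_of_isDensity [SFinite η] {p : X → ℝ} (hp : Integrable p μ)
    {K : X → Y → ℝ} (hK : Measurable fun q : X × Y => K q.1 q.2) (hd : ∀ x, IsDensity η (K x)) :
    Integrable (fun q : X × Y => p q.1 * K q.1 q.2) (μ.prod η) := by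
  have hm : AEStronglyMeasurable (fun q : X × Y => p q.1 * K q.1 q.2) (μ.prod η) :=
    hp.1.comp_fst.mul hK.aestronglyMeasurable
  refine (integrable_prod_iff hm).2 ⟨Eventually.of_forall fun x =>
    (hd x).integrable.const_mul (p x), ?_⟩
  refine hp.norm.congr (Eventually.of_forall fun x => ?_)
  have : ∀ y, ‖p x * K x y‖ = ‖p x‖ * K x y := fun y => by
    rw [norm_mul, Real.norm_of_nonneg ((hd x).nonneg y)]
  simp only [this]
  rw [integral_const_mul, (hd x).integral_eq_one, mul_one]

theorem IsDensity.integrable_mul {p f : X → ℝ} (hp : IsDensity μ p) (hf : AEStronglyMeasurable f μ)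
    {C : ℝ} (hC : ∀ x, |f x| ≤ C) : Integrable (fun x => f x * p x) μ :=
  hp.integrable.bdd_mul (c := C) hf (Eventually.of_forall hC)

theorem IsDensity.abs_integral_mul_le {p f : X → ℝ} (hp : IsDensity μ p) {C : ℝ}
    (hC : ∀ x, |f x| ≤ C) : |∫ x, f x * p x ∂μ| ≤ C := by
  refine (norm_integral_le_of_norm_le (f := fun x => f x * p x) (hp.integrable.const_mul C)
    (Eventually.of_forall fun x => ?_)).trans ?_
  · rw [Real.norm_eq_abs, abs_mul, abs_of_nonneg (hp.nonneg x)]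
    exact mul_le_mul_of_nonneg_right (hC x) (hp.nonneg x)
  · rw [integral_const_mul, hp.integral_eq_one, mul_one]

theorem IsDensity.mul_kernel [SFinite μ] [SFinite η] {p : X → ℝ} (hp : IsDensity μ p)
    {K : X → Y → ℝ} (hK : Measurable fun q : X × Y => K q.1 q.2) (hd : ∀ x, IsDensity η (K x)) :
    IsDensity (μ.prod η) fun q : X × Y => p q.1 * K q.1 q.2 where
  measurable := (hp.measurable.comp measurable_fst).mul hK
  nonneg q := mul_nonneg (hp.nonneg _) ((hd _).nonneg _)
  integral_eq_one := by
    rw [integral_prod _ (integrable_mul_kernel_of_isDensity hp.integrable hK hd)]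
    simp only [integral_const_mul, (hd _).integral_eq_one, mul_one, hp.integral_eq_one]

/-- Fubini's theorem for a bounded function integrated against a density kernel and an integrable
weight. -/
theorem integral_kernel_swap [SFinite μ] [SFinite η] {p : X → ℝ} (hp : Integrable p μ)
    {K : X → Y → ℝ} (hK : Measurable fun q : X × Y => K q.1 q.2) (hd : ∀ x, IsDensity η (K x))
    {f : Y → ℝ} (hf : Measurable f) {C : ℝ} (hC : ∀ y, |f y| ≤ C) :
    ∫ y, f y * ∫ x, K x y * p x ∂μ ∂η = ∫ x, (∫ y, f y * K x y ∂η) * p x ∂μ := by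
  have hi : Integrable (fun q : X × Y => f q.2 * (p q.1 * K q.1 q.2)) (μ.prod η) :=
    (integrable_mul_kernel_of_isDensity hp hK hd).bdd_mul (c := C)
      (hf.comp measurable_snd).aestronglyMeasurable (Eventually.of_forall fun q => hC _)
  simp only [← integral_const_mul, ← integral_mul_const]
  rw [integral_integral_swap]
  · exact integral_congr_ae (Eventually.of_forall fun x =>
      integral_congr_ae (Eventually.of_forall fun y => by ring))
  · refine hi.swap.congr (Eventually.of_forall fun q => ?_)
    simp only [Function.comp, Function.uncurry, Prod.fst_swap, Prod.snd_swap]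
    ring

end Density

/-! ### Measurability of the operations on histories. -/

theorem Hist.mirror_snoc {A O : Type*} {k : ℕ} (o : Fin k → O) (a : Fin k → A) (o₁ o₂ : O) :
    Hist.mirror (Fin.snoc (α := fun _ => O) o o₁, a) o₂ = (Fin.snoc (α := fun _ => O) o o₂, a) := by
  unfold Hist.mirror
  simp [Fin.update_snoc_last (α := fun _ => O)]

section Hist

variable {A O : Type*} [MeasurableSpace A] [MeasurableSpace O] {k : ℕ}

theorem Hist.measurable_extend :
    Measurable fun q : Hist A O k × A × O => q.1.extend q.2.1 q.2.2 := by
  unfold Hist.extend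
  exact (measurable_finSnoc.comp (by fun_prop : Measurable fun q : Hist A O k × A × O =>
    (q.1.1, q.2.2))).prodMk (measurable_finSnoc.comp
      (by fun_prop : Measurable fun q : Hist A O k × A × O => (q.1.2, q.2.1)))

theorem Hist.measurable_mirror : Measurable fun q : Hist A O k × O => q.1.mirror q.2 := by
  unfold Hist.mirror
  exact (measurable_update'.comp (by fun_prop : Measurable fun q : Hist A O k × O =>
    (q.1.1, q.2))).prodMk (by fun_prop)

theorem Policy.measurable_extend_act (π : Policy A O) :
    Measurable fun q : Hist A O k × O => q.1.extend (π.act k q.1.1) q.2 :=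
  Hist.measurable_extend.comp (measurable_fst.prodMk
    (((π.measurable_act k).comp (by fun_prop)).prodMk measurable_snd))

end Hist

/-! ### The Bellman operator with latent state, and Bayes' rule. -/

namespace POMDPClass

variable {Θ S A O : Type*} [MeasurableSpace S] [MeasurableSpace A] [MeasurableSpace O]
  {ν : Measure S} {ρ : Measure O} [SigmaFinite ν]

theorem measurable_nextObs (M : POMDPClass Θ S A O ν ρ) (θ : Θ) {k : ℕ} (hk : k < M.H) :
    Measurable fun q : S × A × O => M.nextObs θ k q.1 q.2.1 q.2.2 := by
  have h1 := (M.emit_measurable θ (k + 1) hk).comp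
    (by fun_prop : Measurable fun q : (S × A × O) × S => (q.2, q.1.2.2))
  have h2 := (M.trans_measurable θ k hk).comp
    (by fun_prop : Measurable fun q : (S × A × O) × S => (q.1.1, q.1.2.1, q.2))
  exact (h1.mul h2).stronglyMeasurable.integral_prod_right'.measurable

theorem measurable_predObs (M : POMDPClass Θ S A O ν ρ) (θ : Θ) {k : ℕ} (hk : k < M.H) :
     Measurable fun q : Hist A O k × A × O =>
    M.predObs θ k q.1 q.2.1 q.2.2 := by
  have h1 : Measurable fun q : (Hist A O k × A × O) × S =>
      M.nextObs θ k q.2 q.1.2.1 q.1.2.2 :=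
    (M.measurable_nextObs θ hk).comp (by fun_prop : Measurable
      fun q : (Hist A O k × A × O) × S => (q.2, q.1.2.1, q.1.2.2))
  have h2 : Measurable fun q : (Hist A O k × A × O) × S => M.forward θ k q.1.1 q.2 :=
    (M.measurable_forward θ hk.le).comp (by fun_prop : Measurable
      fun q : (Hist A O k × A × O) × S => (q.1.1, q.2))
  exact (h1.mul h2).stronglyMeasurable.integral_prod_right'.measurable.div
    h2.stronglyMeasurable.integral_prod_right'.measurable

variable [SigmaFinite ρ]

theorem isDensity_trans_mul_emit (M : POMDPClass Θ S A O ν ρ) (θ : Θ) {k : ℕ} (hk : k < M.H)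
    (s : S) (a : A) : IsDensity (ν.prod ρ) fun p : S × O =>
      M.trans θ k s a p.1 * M.emit θ (k + 1) p.1 p.2 :=
  (M.trans_density θ k hk s a).mul_kernel (M.emit_measurable θ (k + 1) hk)
    (M.emit_density θ (k + 1) hk)

theorem integral_nextObs (M : POMDPClass Θ S A O ν ρ) (θ : Θ) {k : ℕ} (hk : k < M.H)
    (s : S) (a : A) {g : O → ℝ} (hg : Measurable g) {C : ℝ} (hC : ∀ o, |g o| ≤ C) :
    ∫ o, g o * M.nextObs θ k s a o ∂ρ =
      ∫ p : S × O, g p.2 * (M.trans θ k s a p.1 * M.emit θ (k + 1) p.1 p.2) ∂(ν.prod ρ) := by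
  rw [integral_prod_symm (fun p : S × O => g p.2 * (M.trans θ k s a p.1 *
    M.emit θ (k + 1) p.1 p.2)) ((M.isDensity_trans_mul_emit θ hk s a).integrable_mul
    (f := fun p => g p.2) (hg.comp measurable_snd).aestronglyMeasurable fun p => hC p.2)]
  refine integral_congr_ae (Eventually.of_forall fun o => ?_)
  simp only [nextObs, ← integral_const_mul]
  exact integral_congr_ae (Eventually.of_forall fun s' => by ring)

theorem isDensity_nextObs (M : POMDPClass Θ S A O ν ρ) (θ : Θ) {k : ℕ} (hk : k < M.H)
    (s : S) (a : A) : IsDensity ρ (M.nextObs θ k s a) where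
  measurable := (M.measurable_nextObs θ hk).comp
    (by fun_prop : Measurable fun o : O => (s, a, o))
  nonneg o := integral_nonneg fun s' => mul_nonneg ((M.emit_density θ (k + 1) hk _).nonneg _)
    ((M.trans_density θ k hk _ _).nonneg _)
  integral_eq_one := by
    have := M.integral_nextObs θ hk s a (g := fun _ => 1) measurable_const (C := 1) (by simp)
    simpa only [one_mul, (M.isDensity_trans_mul_emit θ hk s a).integral_eq_one] using this

/-- The Bellman operator of the underlying state process: the conditional expectation of `f` at the
next step given the full history and the current state. -/
noncomputable def stateBellman (M : POMDPClass Θ S A O ν ρ) (θ : Θ) (π : Policy A O) (k : ℕ)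
    (f : Hist A O (k + 1) → ℝ) (τ : Hist A O k) (s : S) : ℝ :=
  ∫ o', f (τ.extend (π.act k τ.1) o') * M.nextObs θ k s (π.act k τ.1) o' ∂ρ

theorem abs_stateBellman_le (M : POMDPClass Θ S A O ν ρ) (θ : Θ) (π : Policy A O) {k : ℕ}
    (hk : k < M.H) {f : Hist A O (k + 1) → ℝ} {C : ℝ} (hC : ∀ τ, |f τ| ≤ C)
    (τ : Hist A O k) (s : S) : |M.stateBellman θ π k f τ s| ≤ C :=
  (M.isDensity_nextObs θ hk s _).abs_integral_mul_le fun _ => hC _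

section Bounded

variable (M : POMDPClass Θ S A O ν ρ) (θ : Θ) (π : Policy A O) {k : ℕ} (hk : k < M.H)
  {f : Hist A O (k + 1) → ℝ} (hf : Measurable f) {C : ℝ} (hC : ∀ τ, |f τ| ≤ C)
include hk hf

theorem measurable_stateBellman :
    Measurable fun q : Hist A O k × S => M.stateBellman θ π k f q.1 q.2 := by
  have h1 : Measurable fun q : (Hist A O k × S) × O =>
      f (q.1.1.extend (π.act k q.1.1.1) q.2) :=
    hf.comp (π.measurable_extend_act.comp
      (by fun_prop : Measurable fun q : (Hist A O k × S) × O => (q.1.1, q.2)))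
  have h2 : Measurable fun q : (Hist A O k × S) × O =>
      M.nextObs θ k q.1.2 (π.act k q.1.1.1) q.2 :=
    (M.measurable_nextObs θ hk).comp ((by fun_prop : Measurable
      fun q : (Hist A O k × S) × O => q.1.2).prodMk
        (((π.measurable_act k).comp (by fun_prop)).prodMk measurable_snd))
  exact (h1.mul h2).stronglyMeasurable.integral_prod_right'.measurable

theorem measurable_fullBellman : Measurable (M.fullBellman θ π k f) := by
  have h1 : Measurable fun q : Hist A O k × O => f (q.1.extend (π.act k q.1.1) q.2) :=
    hf.comp π.measurable_extend_act
  have h2 : Measurable fun q : Hist A O k × O => M.predObs θ k q.1 (π.act k q.1.1) q.2 :=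
    (M.measurable_predObs θ hk).comp (measurable_fst.prodMk
      (((π.measurable_act k).comp (by fun_prop)).prodMk measurable_snd))
  exact (h1.mul h2).stronglyMeasurable.integral_prod_right'.measurable

include hC

/-- Bayes' rule. -/
theorem fullBellman_mul_integral_forward {τ : Hist A O k} (hτ : Integrable (M.forward θ k τ) ν) :
    M.fullBellman θ π k f τ * ∫ s, M.forward θ k τ s ∂ν =
      ∫ s, M.stateBellman θ π k f τ s * M.forward θ k τ s ∂ν := by
  -- On histories of zero mass `predObs` is a division by zero, but the forward density vanishes
  -- a.e. there, so both sides are `0`.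
  by_cases h0 : ∫ s, M.forward θ k τ s ∂ν = 0
  · have := (integral_eq_zero_iff_of_nonneg (M.forward_nonneg θ hk.le τ) hτ).1 h0
    rw [h0, mul_zero, integral_eq_zero_of_ae]
    filter_upwards [this] with s hs
    rw [hs]; simp
  · have hN : Measurable fun q : S × O => M.nextObs θ k q.1 (π.act k τ.1) q.2 :=
      (M.measurable_nextObs θ hk).comp (by fun_prop : Measurable
        fun q : S × O => (q.1, π.act k τ.1, q.2))
    have hfm : Measurable fun o' => f (τ.extend (π.act k τ.1) o') :=
      hf.comp (π.measurable_extend_act.comp measurable_prodMk_left)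
    unfold stateBellman
    rw [← integral_kernel_swap hτ hN (fun s => M.isDensity_nextObs θ hk s _) hfm fun _ => hC _,
      fullBellman, ← integral_mul_const]
    refine integral_congr_ae (Eventually.of_forall fun o' => ?_)
    simp only [predObs, mul_assoc, div_mul_cancel₀ _ h0]

/-- Multiplied by the mass of the forward density, the operator is an average of `stateBellman`. The
bound holds at every history, since a zero or undefined mass makes `predObs`, and hence the
operator, equal to `0`. -/
theorem abs_fullBellman_le (τ : Hist A O k) : |M.fullBellman θ π k f τ| ≤ C := by
  by_cases h0 : ∫ s, M.forward θ k τ s ∂ν = 0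
  · simp only [fullBellman, predObs, h0, div_zero, mul_zero, integral_zero, abs_zero]
    exact (abs_nonneg _).trans (hC (τ.extend (π.act k τ.1) (τ.1 0)))
  · have hτ : Integrable (M.forward θ k τ) ν := by
      by_contra h; exact h0 (integral_undef h)
    have hpos : 0 < ∫ s, M.forward θ k τ s ∂ν :=
      lt_of_le_of_ne (integral_nonneg (M.forward_nonneg θ hk.le τ)) (Ne.symm h0)
    refine le_of_mul_le_mul_right ?_ hpos
    rw [← abs_of_pos hpos, ← abs_mul, abs_of_pos hpos,
      M.fullBellman_mul_integral_forward θ π hk hf hC hτ, ← integral_const_mul]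
    refine norm_integral_le_of_norm_le
      (f := fun s => M.stateBellman θ π k f τ s * M.forward θ k τ s) (hτ.const_mul C)
      (Eventually.of_forall fun s => ?_)
    rw [Real.norm_eq_abs, abs_mul, abs_of_nonneg (M.forward_nonneg θ hk.le τ s)]
    exact mul_le_mul_of_nonneg_right (M.abs_stateBellman_le θ π hk hC τ s)
      (M.forward_nonneg θ hk.le τ s)

end Bounded

end POMDPClass

/-! ### The finite-memory operator and the bridge function. -/

namespace POMDPClass

variable {Θ S A O : Type*} [MeasurableSpace S] [MeasurableSpace A] [MeasurableSpace O]
  {ν : Measure S} {ρ : Measure O} [SigmaFinite ν] [SigmaFinite ρ]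

theorem InvertibleObs.ae_lintegral_le {M : POMDPClass Θ S A O ν ρ} {d : ℕ} {ψ : Fin d → S → ℝ}
    {Z : Θ → ℕ → S → O → ℝ} {γ : ℝ} (hZ : M.InvertibleObs ψ Z γ) (θ : Θ) {k : ℕ} (hk : k < M.H) :
    ∀ᵐ o ∂ρ, ∫⁻ s, ‖Z θ k s o‖ₑ ∂ν ≤ ENNReal.ofReal γ :=
  ae_lintegral_kernel_le (hZ.measurable θ k hk) (hZ.integrable_kernel θ k hk)
    (hZ.integrable θ k hk) (hZ.norm_le θ k hk)

-- `𝕆` sees only the a.e. class of `p`, and a convex hull lies in the linear span, where `ℤ` inverts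
-- `𝕆`.
omit [SigmaFinite ν] [SigmaFinite ρ] in
theorem InvertibleObs.left_inv_stateDensity {M : POMDPClass Θ S A O ν ρ} {d : ℕ}
    {ψ : Fin d → S → ℝ} {Z : Θ → ℕ → S → O → ℝ} {γ : ℝ} (hZ : M.InvertibleObs ψ Z γ)
    (hF : M.LinearStates ψ) (θ : Θ) {k : ℕ} (hk : k < M.H) {p : S → ℝ}
    (hp : p ∈ M.stateDensities) :
    (fun s => ∫ o, Z θ k s o * M.obsOp θ k p o ∂ρ) =ᵐ[ν] p := by
  obtain ⟨q, hq, hpq⟩ := hF p hp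
  have hspan : q ∈ Submodule.span ℝ (Set.range ψ) :=
    convexHull_min Submodule.subset_span (Submodule.span ℝ (Set.range ψ)).convex hq
  have : M.obsOp θ k p = M.obsOp θ k q := by
    funext o
    refine integral_congr_ae ?_
    filter_upwards [hpq] with s hs
    rw [hs]
  rw [this]
  exact (hZ.left_inv θ k hk q hspan).trans hpq.symm

omit [SigmaFinite ν] [SigmaFinite ρ] in
theorem priorDensity_mem_stateDensities (M : POMDPClass Θ S A O ν ρ) (θ : Θ) (π : Policy A O)
    {k : ℕ} (hk : k < M.H) (x : Fin k → S × O) :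
    M.priorDensity θ π k x ∈ M.stateDensities := by
  cases k with
  | zero => exact Or.inl ⟨hk, rfl⟩
  | succ k => exact Or.inr ⟨θ, k, _, _, hk, rfl⟩

/-- The value of `f` at the next step when the last observation is drawn anew from the state `s`. -/
noncomputable def mirrorBellman (M : POMDPClass Θ S A O ν ρ) (θ : Θ) (π : Policy A O) (k : ℕ)
    (f : Hist A O (k + 1) → ℝ) (τ : Hist A O k) (s : S) : ℝ :=
  ∫ o₁, M.stateBellman θ π k f (τ.mirror o₁) s * M.emit θ k s o₁ ∂ρ

section Bounded

variable (M : POMDPClass Θ S A O ν ρ) (Z : Θ → ℕ → S → O → ℝ) (θ : Θ) (π : Policy A O) {k : ℕ}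
  (hk : k < M.H) {f : Hist A O (k + 1) → ℝ} (hf : Measurable f) {C : ℝ} (hC : ∀ τ, |f τ| ≤ C)
include hk hf

theorem measurable_mirrorBellman (τ : Hist A O k) : Measurable (M.mirrorBellman θ π k f τ) := by
  have h1 : Measurable fun q : S × O => M.stateBellman θ π k f (τ.mirror q.2) q.1 :=
    (M.measurable_stateBellman θ π hk hf).comp ((Hist.measurable_mirror.comp
      (by fun_prop : Measurable fun q : S × O => (τ, q.2))).prodMk measurable_fst)
  exact (h1.mul (M.emit_measurable θ k hk.le)).stronglyMeasurable.integral_prod_right'.measurable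

theorem measurable_finBellman
    (hZ : Measurable fun p : S × O => Z θ k p.1 p.2) : Measurable (M.finBellman Z θ π k f) := by
  have hm : Measurable fun q : Hist A O k × (O × O) => q.1.mirror q.2.1 :=
    Hist.measurable_mirror.comp (by fun_prop : Measurable
      fun q : Hist A O k × (O × O) => (q.1, q.2.1))
  have ha : Measurable fun q : Hist A O k × (O × O) => π.act k (q.1.mirror q.2.1).1 :=
    (π.measurable_act k).comp (measurable_fst.comp hm)
  have h1 : Measurable fun q : Hist A O k × (O × O) =>
      f ((q.1.mirror q.2.1).extend (π.act k (q.1.mirror q.2.1).1) q.2.2) :=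
    hf.comp (π.measurable_extend_act.comp (hm.prodMk (by fun_prop)))
  have h2 : Measurable fun q : (Hist A O k × (O × O)) × S =>
      (M.emit θ k q.2 q.1.2.1 * M.nextObs θ k q.2 (π.act k (q.1.1.mirror q.1.2.1).1) q.1.2.2) *
        Z θ k q.2 (q.1.1.1 (Fin.last k)) :=
    (((M.emit_measurable θ k hk.le).comp (by fun_prop : Measurable
      fun q : (Hist A O k × (O × O)) × S => (q.2, q.1.2.1))).mul
      ((M.measurable_nextObs θ hk).comp (measurable_snd.prodMk ((ha.comp measurable_fst).prodMk
        (by fun_prop : Measurable fun q : (Hist A O k × (O × O)) × S => q.1.2.2))))).mul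
      (hZ.comp (by fun_prop : Measurable
        fun q : (Hist A O k × (O × O)) × S => (q.2, q.1.1.1 (Fin.last k))))
  exact (h1.mul h2.stronglyMeasurable.integral_prod_right'.measurable
    ).stronglyMeasurable.integral_prod_right'.measurable

include hC

omit hf in
theorem abs_mirrorBellman_le (τ : Hist A O k) (s : S) : |M.mirrorBellman θ π k f τ s| ≤ C :=
  (M.emit_density θ k hk.le s).abs_integral_mul_le fun _ => M.abs_stateBellman_le θ π hk hC _ s

/-- Fubini moves the state integral hidden in `bellmanKernel` to the outside; what remains inside is
the mean of `f` over the redrawn and the next observation. The replaced observation now enters only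
through `Z`. -/
theorem finBellman_eq_integral_mirrorBellman {τ : Hist A O k}
    (hZ : Integrable (fun s => Z θ k s (τ.1 (Fin.last k))) ν) :
    M.finBellman Z θ π k f τ =
      ∫ s, M.mirrorBellman θ π k f τ s * Z θ k s (τ.1 (Fin.last k)) ∂ν := by
  have hm : Measurable fun o : O => τ.mirror o :=
    Hist.measurable_mirror.comp measurable_prodMk_left
  have ha : Measurable fun o : O => π.act k (τ.mirror o).1 :=
    (π.measurable_act k).comp (measurable_fst.comp hm)
  have hN : Measurable fun q : (S × O) × O => M.nextObs θ k q.1.1 (π.act k (τ.mirror q.1.2).1) q.2 :=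
    (M.measurable_nextObs θ hk).comp ((by fun_prop : Measurable
      fun q : (S × O) × O => q.1.1).prodMk ((ha.comp (by fun_prop)).prodMk measurable_snd))
  have hfm : Measurable fun p : O × O =>
      f ((τ.mirror p.1).extend (π.act k (τ.mirror p.1).1) p.2) :=
    hf.comp (π.measurable_extend_act.comp ((hm.comp measurable_fst).prodMk measurable_snd))
  have hK : ∀ s, IsDensity (ρ.prod ρ) fun p : O × O =>
      M.emit θ k s p.1 * M.nextObs θ k s (π.act k (τ.mirror p.1).1) p.2 := fun s =>
    (M.emit_density θ k hk.le s).mul_kernel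
      (K := fun o₁ o₂ => M.nextObs θ k s (π.act k (τ.mirror o₁).1) o₂)
      (hN.comp (by fun_prop : Measurable fun p : O × O => ((s, p.1), p.2)))
      fun o₁ => M.isDensity_nextObs θ hk s _
  have hKm : Measurable fun q : S × (O × O) =>
      M.emit θ k q.1 q.2.1 * M.nextObs θ k q.1 (π.act k (τ.mirror q.2.1).1) q.2.2 :=
    ((M.emit_measurable θ k hk.le).comp (by fun_prop : Measurable
      fun q : S × (O × O) => (q.1, q.2.1))).mul
      (hN.comp (by fun_prop : Measurable fun q : S × (O × O) => ((q.1, q.2.1), q.2.2)))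
  rw [finBellman]
  simp only [bellmanKernel]
  rw [integral_kernel_swap hZ hKm hK hfm fun _ => hC _]
  refine integral_congr_ae (Eventually.of_forall fun s => ?_)
  simp only
  congr 1
  rw [integral_prod _ ((hK s).integrable_mul hfm.aestronglyMeasurable fun _ => hC _)]
  refine integral_congr_ae (Eventually.of_forall fun o₁ => ?_)
  simp only [stateBellman]
  rw [← integral_mul_const]
  exact integral_congr_ae (Eventually.of_forall fun o₂ => by ring)

theorem abs_finBellman_le {γ : ℝ} (hγ : 0 ≤ γ)
    (hZm : Measurable fun p : S × O => Z θ k p.1 p.2) {τ : Hist A O k}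
    (hZ : ∫⁻ s, ‖Z θ k s (τ.1 (Fin.last k))‖ₑ ∂ν ≤ ENNReal.ofReal γ) :
    |M.finBellman Z θ π k f τ| ≤ C * γ := by
  have hi : Integrable (fun s => Z θ k s (τ.1 (Fin.last k))) ν :=
    ⟨(hZm.comp measurable_prodMk_right).aestronglyMeasurable, hZ.trans_lt ENNReal.ofReal_lt_top⟩
  have hC0 : 0 ≤ C := (abs_nonneg _).trans (hC (τ.extend (π.act k τ.1) (τ.1 0)))
  rw [M.finBellman_eq_integral_mirrorBellman Z θ π hk hf hC hi]
  refine (norm_integral_le_of_norm_le (f := fun s => M.mirrorBellman θ π k f τ s *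
    Z θ k s (τ.1 (Fin.last k))) (hi.norm.const_mul C) (Eventually.of_forall fun s => ?_)).trans ?_
  · rw [norm_mul]
    exact mul_le_mul_of_nonneg_right (M.abs_mirrorBellman_le θ π hk hC τ s) (norm_nonneg _)
  · rw [integral_const_mul]
    refine mul_le_mul_of_nonneg_left ?_ hC0
    rw [integral_norm_eq_lintegral_enorm hi.1]
    exact ENNReal.toReal_le_of_le_ofReal hγ hZ

/-- Averaged over a state density that the bridge function reconstructs, the finite-memory Bellman
operator is the Bellman operator of the state process. -/
theorem integral_finBellman_eq_integral_stateBellman {γ : ℝ} (hγ : 0 ≤ γ)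
    (hZm : Measurable fun p : S × O => Z θ k p.1 p.2)
    (hZ : ∀ᵐ o ∂ρ, ∫⁻ s, ‖Z θ k s o‖ₑ ∂ν ≤ ENNReal.ofReal γ)
    {p : S → ℝ} (hp : IsDensity ν p)
    (hZp : (fun s => ∫ o, Z θ k s o * M.obsOp θ k p o ∂ρ) =ᵐ[ν] p)
    (o : Fin k → O) (a : Fin k → A) :
    ∫ q : S × O, M.finBellman Z θ π k f (Fin.snoc (α := fun _ => O) o q.2, a) *
        (p q.1 * M.emit θ k q.1 q.2) ∂(ν.prod ρ) =
      ∫ q : S × O, M.stateBellman θ π k f (Fin.snoc (α := fun _ => O) o q.2, a) q.1 *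
        (p q.1 * M.emit θ k q.1 q.2) ∂(ν.prod ρ) := by
  rcases isEmpty_or_nonempty O with hO | ⟨⟨o₀⟩⟩
  · simp [Measure.eq_zero_of_isEmpty]
  set Ψ : S → ℝ := M.mirrorBellman θ π k f (Fin.snoc (α := fun _ => O) o o₀, a) with hΨ
  have hΨm : Measurable Ψ := M.measurable_mirrorBellman θ π hk hf _
  have hΨC : ∀ s, |Ψ s| ≤ C := fun s => M.abs_mirrorBellman_le θ π hk hC _ s
  have hΨo : ∀ o', M.mirrorBellman θ π k f (Fin.snoc (α := fun _ => O) o o', a) = Ψ := by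
    intro o'
    funext s
    simp only [hΨ, mirrorBellman, Hist.mirror_snoc]
  have hsnoc : Measurable fun o' : O =>
      ((Fin.snoc (α := fun _ => O) o o', a) : Hist A O k) :=
    (measurable_finSnoc.comp measurable_prodMk_left).prodMk measurable_const
  have hE : IsDensity (ν.prod ρ) fun q : S × O => p q.1 * M.emit θ k q.1 q.2 :=
    hp.mul_kernel (M.emit_measurable θ k hk.le) (M.emit_density θ k hk.le)
  have hobs : Integrable (M.obsOp θ k p) ρ := by
    refine hE.integrable.integral_prod_right.congr (Eventually.of_forall fun o' => ?_)
    simp only [obsOp, mul_comm]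
  -- This licenses the exchange of integrals below: the sections of `Z` have L¹ norm at most `γ` for
  -- a.e. observation, and `𝕆 p` is integrable.
  have hZobs : Integrable (fun q : S × O => Z θ k q.1 q.2 * M.obsOp θ k p q.2) (ν.prod ρ) := by
    have hm : AEStronglyMeasurable (fun q : S × O => Z θ k q.1 q.2 * M.obsOp θ k p q.2)
        (ν.prod ρ) := hZm.aestronglyMeasurable.mul hobs.1.comp_snd
    refine (integrable_prod_iff' hm).2 ⟨?_, ?_⟩
    · filter_upwards [hZ] with o' ho'
      exact Integrable.mul_const (f := fun s => Z θ k s o')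
        ⟨(hZm.comp measurable_prodMk_right).aestronglyMeasurable,
          ho'.trans_lt ENNReal.ofReal_lt_top⟩ _
    · refine (hobs.norm.const_mul γ).mono' hm.norm.prod_swap.integral_prod_right' ?_
      filter_upwards [hZ] with o' ho'
      rw [Real.norm_of_nonneg (integral_nonneg fun _ => norm_nonneg _)]
      simp only [norm_mul, integral_mul_const]
      refine mul_le_mul_of_nonneg_right ?_ (norm_nonneg _)
      rw [integral_norm_eq_lintegral_enorm (f := fun s => Z θ k s o')
        (hZm.comp measurable_prodMk_right).aestronglyMeasurable]
      exact ENNReal.toReal_le_of_le_ofReal hγ ho'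
  have hfinae : ∀ᵐ o' ∂ρ, M.finBellman Z θ π k f (Fin.snoc (α := fun _ => O) o o', a) =
      ∫ s, Ψ s * Z θ k s o' ∂ν ∧
      |M.finBellman Z θ π k f (Fin.snoc (α := fun _ => O) o o', a)| ≤ C * γ := by
    filter_upwards [hZ] with o' ho'
    constructor
    · have := M.finBellman_eq_integral_mirrorBellman Z θ π hk hf hC
        (τ := (Fin.snoc (α := fun _ => O) o o', a))
      rw [hΨo] at this
      simp only [Fin.snoc_last] at this
      exact this ⟨(hZm.comp measurable_prodMk_right).aestronglyMeasurable,
        ho'.trans_lt ENNReal.ofReal_lt_top⟩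
    · refine M.abs_finBellman_le Z θ π hk hf hC hγ hZm ?_
      simpa using ho'
  have hfin : Integrable (fun q : S × O =>
      M.finBellman Z θ π k f (Fin.snoc (α := fun _ => O) o q.2, a) *
        (p q.1 * M.emit θ k q.1 q.2)) (ν.prod ρ) := by
    refine hE.integrable.bdd_mul (c := C * γ) ?_ ?_
    · exact (((M.measurable_finBellman Z θ π hk hf hZm).comp hsnoc).comp
        measurable_snd).aestronglyMeasurable
    · filter_upwards [Measure.quasiMeasurePreserving_snd.ae hfinae] with q hq using hq.2
  have hstate : Integrable (fun q : S × O =>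
      M.stateBellman θ π k f (Fin.snoc (α := fun _ => O) o q.2, a) q.1 *
        (p q.1 * M.emit θ k q.1 q.2)) (ν.prod ρ) :=
    hE.integrable_mul ((M.measurable_stateBellman θ π hk hf).comp
      ((hsnoc.comp measurable_snd).prodMk measurable_fst)).aestronglyMeasurable
      fun q => M.abs_stateBellman_le θ π hk hC _ q.1
  calc _ = ∫ o', (∫ s, Ψ s * Z θ k s o' ∂ν) * M.obsOp θ k p o' ∂ρ := by
        rw [integral_prod_symm _ hfin]
        refine integral_congr_ae ?_
        filter_upwards [hfinae] with o' ho'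
        rw [integral_const_mul, ho'.1]
        simp only [obsOp, mul_comm]
    _ = ∫ o', ∫ s, Ψ s * (Z θ k s o' * M.obsOp θ k p o') ∂ν ∂ρ := by
        simp only [← integral_mul_const, mul_assoc]
    _ = ∫ s, ∫ o', Ψ s * (Z θ k s o' * M.obsOp θ k p o') ∂ρ ∂ν := by
        rw [integral_integral_swap]
        exact (hZobs.bdd_mul (c := C) (f := fun q => Ψ q.1)
          (hΨm.comp measurable_fst).aestronglyMeasurable
          (Eventually.of_forall fun q => hΨC q.1)).swap
    -- The only use of the inversion `ℤ 𝕆 p = p`.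
    _ = ∫ s, Ψ s * p s ∂ν := by
        refine integral_congr_ae ?_
        filter_upwards [hZp] with s hs
        rw [integral_const_mul, hs]
    _ = _ := by
        rw [integral_prod _ hstate]
        refine integral_congr_ae (Eventually.of_forall fun s => ?_)
        simp only [hΨ, mirrorBellman, Hist.mirror_snoc]
        rw [← integral_mul_const]
        exact integral_congr_ae (Eventually.of_forall fun o' => by ring)

end Bounded

end POMDPClass

/-! ### Essentially bounded functions and null sets of histories. -/

/-- Clip a measurable representative at the essential supremum. The identities above are proved for
such representatives and carried to L^∞ by the congruence lemmas below. -/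
theorem MeasureTheory.MemLp.exists_measurable_bounded {X : Type*} [MeasurableSpace X]
    {μ : Measure X} {f : X → ℝ} (hf : MemLp f ∞ μ) :
    ∃ g : X → ℝ, ∃ C : ℝ, Measurable g ∧ (∀ x, |g x| ≤ C) ∧ f =ᵐ[μ] g := by
  set C := (eLpNorm f ∞ μ).toReal with hC
  have hC0 : 0 ≤ C := ENNReal.toReal_nonneg
  refine ⟨fun x => max (-C) (min C (hf.1.mk f x)), C, ?_, fun x => ?_, ?_⟩
  · exact measurable_const.max (measurable_const.min hf.1.stronglyMeasurable_mk.measurable)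
  · rw [abs_le]
    exact ⟨le_max_left _ _, max_le (by linarith) (min_le_left _ _)⟩
  · filter_upwards [hf.1.ae_eq_mk, ae_le_eLpNormEssSup (f := f) (μ := μ)] with x hx hb
    rw [← hx]
    have : |f x| ≤ C := by
      rw [hC, ← Real.norm_eq_abs, ← toReal_enorm]
      refine ENNReal.toReal_mono hf.2.ne ?_
      rwa [eLpNorm_exponent_top]
    rw [abs_le] at this
    rw [min_eq_right this.2, max_eq_right this.1]

section Reference

variable {A O : Type*} [MeasurableSpace O] [Fintype A] [MeasurableSpace A] {ρ : Measure O}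
  [SigmaFinite ρ] {k : ℕ}

omit [SigmaFinite ρ] in
theorem ae_histMeasure_iff {P : Hist A O k → Prop} :
    (∀ᵐ τ ∂(histMeasure A ρ k), P τ) ↔
      ∀ a : Fin k → A, ∀ᵐ o ∂(Measure.pi fun _ : Fin (k + 1) => ρ), P (o, a) := by
  constructor
  · intro h a
    have := Measure.ae_ae_of_ae_prod h
    filter_upwards [this] with o ho
    exact Measure.ae_count_iff.1 ho a
  · intro h
    have hsub : {τ : Hist A O k | ¬ P τ} ⊆ ⋃ a : Fin k → A, {o | ¬ P (o, a)} ×ˢ {a} := by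
      rintro ⟨o, a⟩ ho
      exact Set.mem_iUnion.2 ⟨a, ho, rfl⟩
    rw [ae_iff]
    refine measure_mono_null hsub (measure_iUnion_null fun a => ?_)
    rw [histMeasure, Measure.prod_prod, ae_iff.1 (h a), zero_mul]

/-- Only null sets are controlled: unless `ρ` is a probability measure, dropping a coordinate does
not preserve the measure. -/
theorem quasiMeasurePreserving_finInit :
    Measure.QuasiMeasurePreserving (fun (o : Fin (k + 1) → O) (i : Fin k) => o i.castSucc)
      (Measure.pi fun _ : Fin (k + 1) => ρ) (Measure.pi fun _ : Fin k => ρ) := by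
  have h := (Measure.quasiMeasurePreserving_snd (μ := ρ) (ν := Measure.pi fun _ : Fin k => ρ)).comp
    (measurePreserving_piFinSuccAbove (fun _ : Fin (k + 1) => ρ) (Fin.last k)).quasiMeasurePreserving
  convert h using 1
  funext o i
  simp [MeasurableEquiv.piFinSuccAbove, Fin.insertNthEquiv, Fin.init]

theorem ae_finSnoc {P : (Fin (k + 1) → O) → Prop}
    (h : ∀ᵐ o ∂(Measure.pi fun _ : Fin (k + 1) => ρ), P o) :
    ∀ᵐ o ∂(Measure.pi fun _ : Fin k => ρ), ∀ᵐ o' ∂ρ, P (Fin.snoc (α := fun _ => O) o o') :=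
  Measure.ae_ae_of_ae_prod ((measurePreserving_finSnoc ρ k).quasiMeasurePreserving.ae h)

theorem ae_finSnoc_finSnoc {P : (Fin (k + 2) → O) → Prop}
    (h : ∀ᵐ o ∂(Measure.pi fun _ : Fin (k + 2) => ρ), P o) :
    ∀ᵐ o ∂(Measure.pi fun _ : Fin k => ρ), ∀ᵐ p ∂(ρ.prod ρ),
      P (Fin.snoc (α := fun _ => O) (Fin.snoc (α := fun _ => O) o p.1) p.2) := by
  have h1 : MeasurePreserving (fun q : (Fin k → O) × (O × O) =>
      (Fin.snoc (α := fun _ => O) (Fin.snoc (α := fun _ => O) q.1 q.2.1) q.2.2 : Fin (k + 2) → O))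
      ((Measure.pi fun _ : Fin k => ρ).prod (ρ.prod ρ))
      (Measure.pi fun _ : Fin (k + 2) => ρ) :=
    ((measurePreserving_finSnoc ρ (k + 1)).comp
      ((measurePreserving_finSnoc ρ k).prod (MeasurePreserving.id ρ))).comp
        ((measurePreserving_prodAssoc (Measure.pi fun _ : Fin k => ρ) ρ ρ).symm _)
  exact Measure.ae_ae_of_ae_prod (h1.quasiMeasurePreserving.ae h)

end Reference

namespace POMDPClass

variable {Θ S A O : Type*} [MeasurableSpace S] [MeasurableSpace O] [Fintype A] [MeasurableSpace A]
  {ν : Measure S} {ρ : Measure O} [SigmaFinite ν] [SigmaFinite ρ]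

section Congr

variable (M : POMDPClass Θ S A O ν ρ) (Z : Θ → ℕ → S → O → ℝ) (θ : Θ) (π : Policy A O) {k : ℕ}
  {f g : Hist A O (k + 1) → ℝ} (hfg : f =ᵐ[histMeasure A ρ (k + 1)] g)
include hfg

omit [SigmaFinite ν] in
theorem fullBellman_congr_ae :
    M.fullBellman θ π k f =ᵐ[histMeasure A ρ k] M.fullBellman θ π k g := by
  refine ae_histMeasure_iff.2 fun a => ?_
  have h : ∀ b : A, ∀ᵐ o ∂(Measure.pi fun _ : Fin (k + 1) => ρ), ∀ᵐ o' ∂ρ,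
      f (Hist.extend (o, a) b o') = g (Hist.extend (o, a) b o') := fun b =>
    ae_finSnoc (ae_histMeasure_iff.1 hfg (Fin.snoc (α := fun _ => A) a b))
  filter_upwards [ae_all_iff.2 h] with o ho
  refine integral_congr_ae ?_
  filter_upwards [ho (π.act k o)] with o' ho'
  simp only [ho']

-- `𝔹 f` at `τ` evaluates `f` at the earlier observations of `τ` followed by a fresh pair. For a.e.
-- choice of the earlier observations the exceptional pairs are null, simultaneously for the
-- finitely many actions.
omit [SigmaFinite ν] in
theorem finBellman_congr_ae :
    M.finBellman Z θ π k f =ᵐ[histMeasure A ρ k] M.finBellman Z θ π k g := by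
  refine ae_histMeasure_iff.2 fun a => ?_
  have h : ∀ b : A, ∀ᵐ o ∂(Measure.pi fun _ : Fin k => ρ), ∀ᵐ p ∂(ρ.prod ρ),
      f (Hist.extend (Fin.snoc (α := fun _ => O) o p.1, a) b p.2) =
        g (Hist.extend (Fin.snoc (α := fun _ => O) o p.1, a) b p.2) := fun b =>
    ae_finSnoc_finSnoc (ae_histMeasure_iff.1 hfg (Fin.snoc (α := fun _ => A) a b))
  filter_upwards [quasiMeasurePreserving_finInit.ae (ae_all_iff.2 h)] with o ho
  have ho' : o = Fin.snoc (α := fun _ => O) (fun i => o i.castSucc) (o (Fin.last k)) :=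
    (Fin.snoc_init_self (α := fun _ => O) o).symm
  have hmir : ∀ o₁, Hist.mirror (o, a) o₁ =
      (Fin.snoc (α := fun _ => O) (fun i => o i.castSucc) o₁, a) := by
    intro o₁
    conv_lhs => rw [ho']
    exact Hist.mirror_snoc _ _ _ _
  refine integral_congr_ae ?_
  filter_upwards [ae_all_iff.2 ho] with p hp
  simp only [hmir, hp]

end Congr

end POMDPClass

/-! ### Averages along trajectories, weighted by functions of the past. -/

namespace POMDPClass

variable {Θ S A O : Type*} [MeasurableSpace S] [MeasurableSpace O] [Fintype A] [MeasurableSpace A]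
  {ν : Measure S} {ρ : Measure O} [SigmaFinite ν] [SigmaFinite ρ]

theorem ae_prefixLaw_histOf (M : POMDPClass Θ S A O ν ρ) (θ : Θ) (π : Policy A O) {k : ℕ}
    (hk : k ≤ M.H) {P : Hist A O k → Prop} (hP : ∀ᵐ τ ∂(histMeasure A ρ k), P τ) :
    ∀ᵐ x ∂(M.prefixLaw θ π (k + 1)), P (π.histOf k fun i => (x i).2) := by
  have h := (M.map_obs_absolutelyContinuous θ π hk).ae_le (ae_all_iff.2 (ae_histMeasure_iff.1 hP))
  filter_upwards [ae_of_ae_map (f := fun (x : Fin (k + 1) → S × O) i => (x i).2)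
    (Measurable.aemeasurable (by fun_prop)) h] with x hx
  exact hx _

theorem integrable_prefixLaw_of_memLp (M : POMDPClass Θ S A O ν ρ) (θ : Θ) (π : Policy A O) {k : ℕ}
    (hk : k ≤ M.H) {F : Hist A O k → ℝ} (hF : MemLp F ∞ (histMeasure A ρ k)) :
    Integrable (fun x => F (π.histOf k fun i => (x i).2)) (M.prefixLaw θ π (k + 1)) := by
  have := M.isProbabilityMeasure_prefixLaw θ π (k := k + 1) (by omega)
  obtain ⟨g, C, hg, hC, hfg⟩ := hF.exists_measurable_bounded
  refine Integrable.congr (f := fun x => g (π.histOf k fun i => (x i).2)) ?_ ?_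
  · refine Integrable.of_bound (C := C) (hg.comp ((π.measurable_histOf k).comp
      (by fun_prop))).aestronglyMeasurable (Eventually.of_forall fun x => hC _)
  · filter_upwards [M.ae_prefixLaw_histOf θ π hk hfg] with x hx using hx.symm

omit [Fintype A] in
theorem measurePreserving_law (M : POMDPClass Θ S A O ν ρ) (θ : Θ) (π : Policy A O) {k : ℕ}
    (hk : k ≤ M.H) : MeasurePreserving
      (fun (ω : Fin (M.H + 1) → S × O) (i : Fin (k + 1)) => ω (Fin.castLE (by omega) i))
      (M.law θ π) (M.prefixLaw θ π (k + 1)) :=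
  ⟨by fun_prop, M.map_law θ π (by omega)⟩

theorem integrable_law_of_memLp (M : POMDPClass Θ S A O ν ρ) (θ : Θ) (π : Policy A O) {k : ℕ}
    (hk : k ≤ M.H) {F : Hist A O k → ℝ} (hF : MemLp F ∞ (histMeasure A ρ k)) :
    Integrable (fun ω => F (π.hist k hk ω)) (M.law θ π) :=
  (M.measurePreserving_law θ π hk).integrable_comp_of_integrable
    (M.integrable_prefixLaw_of_memLp θ π hk hF)

theorem memLp_fullBellman (M : POMDPClass Θ S A O ν ρ) (θ : Θ) (π : Policy A O) {k : ℕ}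
    (hk : k < M.H) {f : Hist A O (k + 1) → ℝ} (hf : MemLp f ∞ (histMeasure A ρ (k + 1))) :
    MemLp (M.fullBellman θ π k f) ∞ (histMeasure A ρ k) := by
  obtain ⟨g, C, hg, hC, hfg⟩ := hf.exists_measurable_bounded
  refine (memLp_congr_ae (M.fullBellman_congr_ae θ π hfg)).2 ?_
  exact memLp_top_of_bound (M.measurable_fullBellman θ π hk hg).aestronglyMeasurable C
    (Eventually.of_forall fun τ => M.abs_fullBellman_le θ π hk hg hC τ)

theorem memLp_finBellman (M : POMDPClass Θ S A O ν ρ) {d : ℕ} {ψ : Fin d → S → ℝ}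
    {Z : Θ → ℕ → S → O → ℝ} {γ : ℝ} (hγ : 0 ≤ γ) (hZ : M.InvertibleObs ψ Z γ) (θ : Θ)
    (π : Policy A O) {k : ℕ} (hk : k < M.H) {f : Hist A O (k + 1) → ℝ}
    (hf : MemLp f ∞ (histMeasure A ρ (k + 1))) :
    MemLp (M.finBellman Z θ π k f) ∞ (histMeasure A ρ k) := by
  obtain ⟨g, C, hg, hC, hfg⟩ := hf.exists_measurable_bounded
  refine (memLp_congr_ae (M.finBellman_congr_ae Z θ π hfg)).2 ?_
  refine memLp_top_of_bound (M.measurable_finBellman Z θ π hk hg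
    (hZ.measurable θ k hk)).aestronglyMeasurable (C * γ) (ae_histMeasure_iff.2 fun a => ?_)
  filter_upwards [(Measure.quasiMeasurePreserving_eval (fun _ : Fin (k + 1) => ρ)
    (Fin.last k)).ae (hZ.ae_lintegral_le θ hk)] with o ho
  exact M.abs_finBellman_le Z θ π hk hg hC hγ (hZ.measurable θ k hk) ho

section Average

variable (M : POMDPClass Θ S A O ν ρ) (θ : Θ) (π π' : Policy A O) {k : ℕ} (hk : k < M.H)
  {w : (Fin k → O) → ℝ} (hw : Measurable w) (hw1 : ∀ o, |w o| ≤ 1)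
include hk hw hw1

-- For a.e. observation sequence this is Bayes' rule under the integral. The policy `π'` only
-- produces the history; the action of step `k` inside both operators is that of `π`.
omit [Fintype A] in
theorem integral_fullBellman_eq_stateBellman {f : Hist A O (k + 1) → ℝ} (hf : Measurable f)
    {C : ℝ} (hC : ∀ τ, |f τ| ≤ C) :
    ∫ x, w (fun i => (x i.castSucc).2) * M.fullBellman θ π k f (π'.histOf k fun i => (x i).2)
        ∂(M.prefixLaw θ π' (k + 1)) =
      ∫ x, w (fun i => (x i.castSucc).2) * M.stateBellman θ π k f (π'.histOf k fun i => (x i).2)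
        (x (Fin.last k)).1 ∂(M.prefixLaw θ π' (k + 1)) := by
  have hwm : Measurable fun q : (Fin (k + 1) → O) × S => w fun i => q.1 i.castSucc :=
    hw.comp (by fun_prop)
  have hbd : ∀ {u : (Fin (k + 1) → O) × S → ℝ}, (∀ q, |u q| ≤ C) →
      ∀ q : (Fin (k + 1) → O) × S, |w (fun i => q.1 i.castSucc) * u q| ≤ C := by
    intro u hu q
    rw [abs_mul]
    exact (mul_le_mul (hw1 _) (hu q) (abs_nonneg _) zero_le_one).trans (one_mul C).le
  refine (M.integral_forward θ π' hk.le
    (F := fun q => w (fun i => q.1 i.castSucc) * M.fullBellman θ π k f (π'.histOf k q.1))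
    (hwm.mul ((M.measurable_fullBellman θ π hk hf).comp ((π'.measurable_histOf k).comp
      measurable_fst))) (hbd fun q => M.abs_fullBellman_le θ π hk hf hC _)).trans
    (Eq.trans ?_ (M.integral_forward θ π' hk.le
    (F := fun q => w (fun i => q.1 i.castSucc) * M.stateBellman θ π k f (π'.histOf k q.1) q.2)
    (hwm.mul ((M.measurable_stateBellman θ π hk hf).comp (((π'.measurable_histOf k).comp
      measurable_fst).prodMk measurable_snd)))
      (hbd fun q => M.abs_stateBellman_le θ π hk hC _ _)).symm)
  refine integral_congr_ae ?_
  filter_upwards [(M.integrable_forward θ π' hk.le).prod_right_ae] with o ho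
  simp only [mul_assoc, integral_const_mul]
  rw [M.fullBellman_mul_integral_forward θ π hk hf hC ho]

omit [Fintype A] in
theorem integral_next_eq_stateBellman {f : Hist A O (k + 1) → ℝ} (hf : Measurable f)
    {C : ℝ} (hC : ∀ τ, |f τ| ≤ C) (hπ : π'.act k = π.act k) :
    ∫ x, w (fun i => (x i.castSucc.castSucc).2) * f (π'.histOf (k + 1) fun i => (x i).2)
        ∂(M.prefixLaw θ π' (k + 2)) =
      ∫ x, w (fun i => (x i.castSucc).2) * M.stateBellman θ π k f (π'.histOf k fun i => (x i).2)
        (x (Fin.last k)).1 ∂(M.prefixLaw θ π' (k + 1)) := by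
  have := M.isProbabilityMeasure_prefixLaw θ π' (k := k + 2) (by omega)
  rw [M.integral_prefixLaw_succ θ π' hk]
  · refine integral_congr_ae (Eventually.of_forall fun x => ?_)
    simp only [snd_finSnoc, Policy.histOf_snoc, Fin.snoc_castSucc, mul_assoc, integral_const_mul]
    congr 1
    rw [stateBellman]
    refine Eq.symm ((M.integral_nextObs θ hk _ _ (C := C) (g := fun o' =>
      f ((π'.histOf k fun i => (x i).2).extend (π.act k fun i => (x i).2) o')) (hf.comp
      (π.measurable_extend_act.comp measurable_prodMk_left)) fun _ => hC _).trans ?_)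
    -- The action executed at step `k` belongs to `π'`, the one in `stateBellman` to `π`.
    simp only [priorDensity, hπ]
    rfl
  · refine Integrable.of_bound (C := C) (Measurable.aestronglyMeasurable ?_)
      (Eventually.of_forall fun x => ?_)
    · exact (hw.comp (by fun_prop)).mul (hf.comp ((π'.measurable_histOf _).comp (by fun_prop)))
    · rw [Real.norm_eq_abs, abs_mul]
      exact (mul_le_mul (hw1 _) (hC _) (abs_nonneg _) zero_le_one).trans (one_mul C).le

variable {d : ℕ} {ψ : Fin d → S → ℝ} {Z : Θ → ℕ → S → O → ℝ} {γ : ℝ} (hγ : 0 ≤ γ)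
  (hF : M.LinearStates ψ) (hZ : M.InvertibleObs ψ Z γ)
include hγ hF hZ

/-- Given the states and observations of the earlier steps, `w` is a constant and the density of the
current state is one that the bridge function reconstructs, so the averaged identity applies
pointwise in the past. -/
theorem integral_finBellman_eq_stateBellman {f : Hist A O (k + 1) → ℝ} (hf : Measurable f)
    {C : ℝ} (hC : ∀ τ, |f τ| ≤ C) :
    ∫ x, w (fun i => (x i.castSucc).2) * M.finBellman Z θ π k f (π'.histOf k fun i => (x i).2)
        ∂(M.prefixLaw θ π' (k + 1)) =
      ∫ x, w (fun i => (x i.castSucc).2) * M.stateBellman θ π k f (π'.histOf k fun i => (x i).2)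
        (x (Fin.last k)).1 ∂(M.prefixLaw θ π' (k + 1)) := by
  have := M.isProbabilityMeasure_prefixLaw θ π' (k := k + 1) (by omega)
  have hwm : Measurable fun x : Fin (k + 1) → S × O => w fun i => (x i.castSucc).2 :=
    hw.comp (by fun_prop)
  rw [M.integral_prefixLaw_succ θ π' hk.le, M.integral_prefixLaw_succ θ π' hk.le]
  · refine integral_congr_ae (Eventually.of_forall fun x => ?_)
    simp only [snd_finSnoc, Policy.histOf_snoc_eq, Fin.snoc_castSucc, Fin.snoc_last, mul_assoc,
      integral_const_mul]
    congr 1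
    exact M.integral_finBellman_eq_integral_stateBellman Z θ π hk hf hC hγ
      (hZ.measurable θ k hk) (hZ.ae_lintegral_le θ hk) (M.isDensity_priorDensity θ π' hk.le x)
      (hZ.left_inv_stateDensity hF θ hk (M.priorDensity_mem_stateDensities θ π' hk x)) _ _
  · refine Integrable.of_bound (C := C) (Measurable.aestronglyMeasurable ?_)
      (Eventually.of_forall fun x => ?_)
    · exact hwm.mul ((M.measurable_stateBellman θ π hk hf).comp
        (((π'.measurable_histOf k).comp (by fun_prop)).prodMk (by fun_prop)))
    · rw [Real.norm_eq_abs, abs_mul]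
      exact (mul_le_mul (hw1 _) (M.abs_stateBellman_le θ π hk hC _ _) (abs_nonneg _)
        zero_le_one).trans (one_mul C).le
  -- Unlike `stateBellman`, the finite-memory operator is bounded only almost everywhere, so
  -- integrability goes through L^∞.
  · refine (M.integrable_prefixLaw_of_memLp θ π' hk.le (M.memLp_finBellman hγ hZ θ π hk
      (f := f) ?_)).bdd_mul (c := 1) hwm.aestronglyMeasurable (Eventually.of_forall fun x => hw1 _)
    exact memLp_top_of_bound hf.aestronglyMeasurable C (Eventually.of_forall hC)

variable {f : Hist A O (k + 1) → ℝ} (hf : MemLp f ∞ (histMeasure A ρ (k + 1)))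
include hf

theorem integral_finBellman_eq_fullBellman :
    ∫ x, w (fun i => (x i.castSucc).2) * M.finBellman Z θ π k f (π'.histOf k fun i => (x i).2)
        ∂(M.prefixLaw θ π' (k + 1)) =
      ∫ x, w (fun i => (x i.castSucc).2) * M.fullBellman θ π k f (π'.histOf k fun i => (x i).2)
        ∂(M.prefixLaw θ π' (k + 1)) := by
  obtain ⟨g, C, hg, hC, hfg⟩ := hf.exists_measurable_bounded
  have h := (M.integral_finBellman_eq_stateBellman θ π π' hk hw hw1 hγ hF hZ hg hC).trans
    (M.integral_fullBellman_eq_stateBellman θ π π' hk hw hw1 hg hC).symm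
  refine Eq.trans (integral_congr_ae ?_) (h.trans (integral_congr_ae ?_))
  · filter_upwards [M.ae_prefixLaw_histOf θ π' hk.le (M.finBellman_congr_ae Z θ π hfg)] with x hx
    rw [hx]
  · filter_upwards [M.ae_prefixLaw_histOf θ π' hk.le (M.fullBellman_congr_ae θ π hfg)] with x hx
    rw [hx]

theorem integral_finBellman_eq_next (hπ : π'.act k = π.act k) :
    ∫ x, w (fun i => (x i.castSucc).2) * M.finBellman Z θ π k f (π'.histOf k fun i => (x i).2)
        ∂(M.prefixLaw θ π' (k + 1)) =
      ∫ x, w (fun i => (x i.castSucc.castSucc).2) * f (π'.histOf (k + 1) fun i => (x i).2)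
        ∂(M.prefixLaw θ π' (k + 2)) := by
  obtain ⟨g, C, hg, hC, hfg⟩ := hf.exists_measurable_bounded
  have h := (M.integral_finBellman_eq_stateBellman θ π π' hk hw hw1 hγ hF hZ hg hC).trans
    (M.integral_next_eq_stateBellman θ π π' hk hw hw1 hg hC hπ).symm
  refine Eq.trans (integral_congr_ae ?_) (h.trans (integral_congr_ae ?_))
  · filter_upwards [M.ae_prefixLaw_histOf θ π' hk.le (M.finBellman_congr_ae Z θ π hfg)] with x hx
    rw [hx]
  · filter_upwards [M.ae_prefixLaw_histOf θ π' hk hfg] with x hx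
    rw [hx]

end Average

end POMDPClass

/-! ### Conditional expectations and the value functions. -/

theorem MeasureTheory.condExp_ae_eq_zero {Ω : Type*} {m m0 : MeasurableSpace Ω} {μ : Measure Ω}
    [IsFiniteMeasure μ] (hm : m ≤ m0) {h : Ω → ℝ} (hi : Integrable h μ)
    (h0 : ∀ G, MeasurableSet[m] G → ∫ ω in G, h ω ∂μ = 0) : μ[h | m] =ᵐ[μ] 0 :=
  (ae_eq_condExp_of_forall_setIntegral_eq hm hi (fun _ _ _ => integrableOn_zero)
    (fun G hG _ => by simp [h0 G hG]) stronglyMeasurable_zero.aestronglyMeasurable).symm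

namespace Policy

variable {S A O : Type*} [MeasurableSpace S] [MeasurableSpace A] [MeasurableSpace O]

theorem measurable_past (π : Policy A O) {n k : ℕ} (hk : k ≤ n) :
    Measurable (π.past (S := S) k hk) :=
  (POMDPClass.measurable_obsUpTo (by omega)).prodMk
    ((π.measurable_acts k).comp (POMDPClass.measurable_obsUpTo (by omega)))

theorem pastSigma_le (π : Policy A O) {n k : ℕ} (hk : k ≤ n) :
    π.pastSigma (S := S) k hk ≤ MeasurableSpace.pi :=
  (π.measurable_past hk).comap_le

theorem pastSigma_mono (π : Policy A O) {n k : ℕ} (hk : k + 1 ≤ n) :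
    π.pastSigma (S := S) k (by omega) ≤ π.pastSigma (k + 1) hk := by
  rintro _ ⟨G, hG, rfl⟩
  exact ⟨(fun q : (Fin (k + 1) → O) × (Fin (k + 1) → A) =>
    (fun i => q.1 (Fin.castSucc i), fun i => q.2 (Fin.castSucc i))) ⁻¹' G,
    (by fun_prop : Measurable fun q : (Fin (k + 1) → O) × (Fin (k + 1) → A) =>
      ((fun i => q.1 (Fin.castSucc i) : Fin k → O), (fun i => q.2 (Fin.castSucc i) : Fin k → A))) hG,
    rfl⟩

end Policy

namespace POMDPClass

variable {Θ S A O : Type*} [MeasurableSpace S] [MeasurableSpace O] [MeasurableSpace A]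
  {ν : Measure S} {ρ : Measure O}

theorem measurable_trajReward (M : POMDPClass Θ S A O ν ρ) (π : Policy A O) :
    Measurable (M.trajReward (S := S) π) := by
  refine Finset.measurable_sum _ fun i _ => ?_
  exact M.reward_measurable.comp ((by fun_prop : Measurable
    fun ω : Fin (M.H + 1) → S × O => (ω i.castSucc).2).prodMk
      ((π.measurable_act i).comp (measurable_obsUpTo _)))

theorem abs_trajReward_le (M : POMDPClass Θ S A O ν ρ) (π : Policy A O)
    (ω : Fin (M.H + 1) → S × O) : |M.trajReward π ω| ≤ M.H := by
  refine (Finset.abs_sum_le_sum_abs _ _).trans ((Finset.sum_le_card_nsmul _ _ 1 fun i _ => ?_).trans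
    (by simp))
  rw [abs_of_nonneg (M.reward_mem _ _).1]
  exact (M.reward_mem _ _).2

theorem memLp_histReward (M : POMDPClass Θ S A O ν ρ) (k : ℕ) :
    MemLp (M.histReward (k := k)) ∞ (histMeasure A ρ k) := by
  refine memLp_top_of_bound (C := k) (Measurable.aestronglyMeasurable ?_)
    (Eventually.of_forall fun τ => ?_)
  · refine Finset.measurable_sum _ fun i _ => ?_
    exact M.reward_measurable.comp (by fun_prop : Measurable
      fun τ : Hist A O k => (τ.1 i.castSucc, τ.2 i))
  · refine (Finset.abs_sum_le_sum_abs _ _).trans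
      ((Finset.sum_le_card_nsmul _ _ 1 fun i _ => ?_).trans (by simp))
    rw [abs_of_nonneg (M.reward_mem _ _).1]
    exact (M.reward_mem _ _).2

theorem histReward_hist (M : POMDPClass Θ S A O ν ρ) (π : Policy A O)
    (ω : Fin (M.H + 1) → S × O) :
    M.histReward (π.hist M.H le_rfl ω) = M.trajReward π ω := rfl

theorem value_of_lt (M : POMDPClass Θ S A O ν ρ) (Z : Θ → ℕ → S → O → ℝ) (θ : Θ)
    (π : Policy A O) {k : ℕ} (hk : k < M.H) :
    M.value Z θ π k = M.finBellman Z θ π k (M.value Z θ π (k + 1)) := by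
  rw [value, if_pos hk]

theorem value_of_le (M : POMDPClass Θ S A O ν ρ) (Z : Θ → ℕ → S → O → ℝ) (θ : Θ)
    (π : Policy A O) {k : ℕ} (hk : M.H ≤ k) : M.value Z θ π k = M.histReward := by
  rw [value, if_neg (not_lt.2 hk)]

variable [SigmaFinite ν] [SigmaFinite ρ]

theorem integrable_trajReward (M : POMDPClass Θ S A O ν ρ) (θ : Θ) (π : Policy A O) :
    Integrable (M.trajReward π) (M.law θ π) :=
  Integrable.of_bound (C := M.H) (M.measurable_trajReward π).aestronglyMeasurable
    (Eventually.of_forall (M.abs_trajReward_le π))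

theorem prefixLaw_one_congr (M : POMDPClass Θ S A O ν ρ) {θ θ' : Θ} (π π' : Policy A O)
    (h : M.emit θ' 0 = M.emit θ 0) : M.prefixLaw θ' π' 1 = M.prefixLaw θ π 1 := by
  have : M.stepKernel θ' π' 0 = M.stepKernel θ π 0 := by
    simp only [stepKernel, priorDensity, h]
  simp only [prefixLaw, this]

variable [Fintype A]

/-- Translates integrals over events of the past into weighted integrals against prefix laws. It is
needed for `n = 0` and `n = 1`, the current and the next history with the same past. -/
theorem setIntegral_hist (M : POMDPClass Θ S A O ν ρ) (θ : Θ) (π : Policy A O) {k : ℕ}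
    (hk : k ≤ M.H) (n : ℕ) (hn : k + n ≤ M.H) {F : Hist A O (k + n) → ℝ}
    (hF : MemLp F ∞ (histMeasure A ρ (k + n))) {w : (Fin k → O) → ℝ} (hw : Measurable w)
    {G : Set (Fin (M.H + 1) → S × O)} (hG : MeasurableSet G)
    (hwG : ∀ ω, w (fun i => (ω (Fin.castLE (by omega) i)).2) = G.indicator 1 ω) :
    ∫ ω in G, F (π.hist (k + n) hn ω) ∂(M.law θ π) =
      ∫ x, w (fun i => (x (Fin.castLE (by omega) i)).2) * F (π.histOf (k + n) fun i => (x i).2)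
        ∂(M.prefixLaw θ π (k + n + 1)) := by
  have hmp := M.measurePreserving_law θ π hn
  have hm : AEStronglyMeasurable (fun x : Fin (k + n + 1) → S × O =>
      w (fun i => (x (Fin.castLE (by omega) i)).2) * F (π.histOf (k + n) fun i => (x i).2))
      (M.prefixLaw θ π (k + n + 1)) :=
    (hw.comp (by fun_prop)).aestronglyMeasurable.mul
      (M.integrable_prefixLaw_of_memLp θ π hn hF).1
  rw [← hmp.map_eq] at hm ⊢
  rw [integral_map hmp.aemeasurable hm, ← integral_indicator hG]
  refine integral_congr_ae (Eventually.of_forall fun ω => ?_)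
  have := hwG ω
  simp only [Fin.castLE_castLE] at this ⊢
  rw [this]
  by_cases hω : ω ∈ G
  · simp [hω]; rfl
  · simp [hω]

section

variable (M : POMDPClass Θ S A O ν ρ) (θ : Θ) (π π' : Policy A O) {k : ℕ} (hk : k < M.H)
  {d : ℕ} {ψ : Fin d → S → ℝ} {Z : Θ → ℕ → S → O → ℝ} {γ : ℝ} (hγ : 0 ≤ γ)
  (hF : M.LinearStates ψ) (hZ : M.InvertibleObs ψ Z γ)

-- Past actions are functions of past observations because the policy is deterministic, so the
-- indicator of a past event is a function of the observations alone.
omit [SigmaFinite ν] [SigmaFinite ρ] [Fintype A] in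
theorem exists_weight {G : Set (Fin (M.H + 1) → S × O)}
    (hG : MeasurableSet[π'.pastSigma k hk.le] G) :
    ∃ w : (Fin k → O) → ℝ, Measurable w ∧ (∀ o, |w o| ≤ 1) ∧
      ∀ ω : Fin (M.H + 1) → S × O,
        w (fun i => (ω (Fin.castLE (by omega) i)).2) = G.indicator 1 ω := by
  obtain ⟨G', hG', rfl⟩ := hG
  refine ⟨fun o => G'.indicator 1 (o, π'.acts k o), ?_, fun o => ?_, fun ω => rfl⟩
  · exact (measurable_one.indicator hG').comp (measurable_id.prodMk (π'.measurable_acts k))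
  · by_cases h : (o, π'.acts k o) ∈ G' <;> simp [h]

include hγ hF hZ

theorem setIntegral_finBellman_eq_fullBellman {f : Hist A O (k + 1) → ℝ}
    (hf : MemLp f ∞ (histMeasure A ρ (k + 1))) {G : Set (Fin (M.H + 1) → S × O)}
    (hG : MeasurableSet[π'.pastSigma k hk.le] G) :
    ∫ ω in G, M.finBellman Z θ π k f (π'.hist k hk.le ω) ∂(M.law θ π') =
      ∫ ω in G, M.fullBellman θ π k f (π'.hist k hk.le ω) ∂(M.law θ π') := by
  obtain ⟨w, hw, hw1, hwG⟩ := M.exists_weight π' hk hG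
  have hGm := π'.pastSigma_le hk.le G hG
  exact ((M.setIntegral_hist θ π' hk.le 0 hk.le (M.memLp_finBellman hγ hZ θ π hk hf) hw hGm
    hwG).trans (M.integral_finBellman_eq_fullBellman θ π π' hk hw hw1 hγ hF hZ hf)).trans
    (M.setIntegral_hist θ π' hk.le 0 hk.le (M.memLp_fullBellman θ π hk hf) hw hGm hwG).symm

theorem setIntegral_finBellman_eq_next (hπ : π'.act k = π.act k) {f : Hist A O (k + 1) → ℝ}
    (hf : MemLp f ∞ (histMeasure A ρ (k + 1))) {G : Set (Fin (M.H + 1) → S × O)}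
    (hG : MeasurableSet[π'.pastSigma k hk.le] G) :
    ∫ ω in G, M.finBellman Z θ π k f (π'.hist k hk.le ω) ∂(M.law θ π') =
      ∫ ω in G, f (π'.hist (k + 1) hk ω) ∂(M.law θ π') := by
  obtain ⟨w, hw, hw1, hwG⟩ := M.exists_weight π' hk hG
  have hGm := π'.pastSigma_le hk.le G hG
  exact ((M.setIntegral_hist θ π' hk.le 0 hk.le (M.memLp_finBellman hγ hZ θ π hk hf) hw hGm
    hwG).trans (M.integral_finBellman_eq_next θ π π' hk hw hw1 hγ hF hZ hf hπ)).trans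
    (M.setIntegral_hist θ π' hk.le 1 hk hf hw hGm hwG).symm

end

theorem memLp_value (M : POMDPClass Θ S A O ν ρ) {d : ℕ} {ψ : Fin d → S → ℝ}
    {Z : Θ → ℕ → S → O → ℝ} {γ : ℝ} (hγ : 0 ≤ γ) (hZ : M.InvertibleObs ψ Z γ) (θ : Θ)
    (π : Policy A O) {k : ℕ} (hk : k ≤ M.H) :
    MemLp (M.value Z θ π k) ∞ (histMeasure A ρ k) := by
  induction hk using Nat.decreasingInduction with
  | self => rw [M.value_of_le Z θ π le_rfl]; exact M.memLp_histReward _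
  | of_succ k hk ih =>
    rw [M.value_of_lt Z θ π hk]
    exact M.memLp_finBellman hγ hZ θ π hk ih

/-- Downward induction on `k`. An event of the past of step `k` is also one of step `k + 1`
(`pastSigma_mono`), so the next instance of the identity applies to the same `G`. -/
theorem setIntegral_value (M : POMDPClass Θ S A O ν ρ) {d : ℕ} {ψ : Fin d → S → ℝ}
    {Z : Θ → ℕ → S → O → ℝ} {γ : ℝ} (hγ : 0 ≤ γ) (hF : M.LinearStates ψ)
    (hZ : M.InvertibleObs ψ Z γ) (θ : Θ) (π π' : Policy A O) {k : ℕ} (hk : k ≤ M.H)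
    (hπ : ∀ i, k ≤ i → i < M.H → π'.act i = π.act i) {G : Set (Fin (M.H + 1) → S × O)}
    (hG : MeasurableSet[π'.pastSigma k hk] G) :
    ∫ ω in G, M.value Z θ π k (π'.hist k hk ω) ∂(M.law θ π') =
      ∫ ω in G, M.trajReward π' ω ∂(M.law θ π') := by
  induction hk using Nat.decreasingInduction with
  | self => simp only [M.value_of_le Z θ π le_rfl, M.histReward_hist]
  | of_succ k hk ih =>
    rw [M.value_of_lt Z θ π hk, M.setIntegral_finBellman_eq_next θ π π' hk hγ hF hZ
      (hπ k le_rfl hk) (M.memLp_value hγ hZ θ π hk) hG]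
    exact ih (fun i hi => hπ i (by omega)) (π'.pastSigma_mono hk G hG)

end POMDPClass

/-! ### The three assertions. -/

theorem mainTheorem2 {Θ S A O : Type*} [MeasurableSpace S] [MeasurableSpace O]
    [Fintype A] [MeasurableSpace A] [MeasurableSingletonClass A]
    (ν : Measure S) [SigmaFinite ν] (ρ : Measure O) [SigmaFinite ρ]
    (M : POMDPClass Θ S A O ν ρ)
    {d : ℕ} (ψ : Fin d → S → ℝ) (hψ : ∀ i, IsDensity ν (ψ i)) (hF : M.LinearStates ψ)
    (Z : Θ → ℕ → S → O → ℝ) (γ : ℝ) (hγ : 0 < γ) (hZ : M.InvertibleObs ψ Z γ)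
    (θ : Θ) (π : Policy A O) :
    (∀ (k : ℕ) (hk : k < M.H) (f : Hist A O (k + 1) → ℝ),
      MemLp f ∞ (histMeasure A ρ (k + 1)) →
        MemLp (M.finBellman Z θ π k f) ∞ (histMeasure A ρ k) ∧
        MemLp (M.fullBellman θ π k f) ∞ (histMeasure A ρ k) ∧
        ∀ π' : Policy A O,
          Integrable (fun ω => M.finBellman Z θ π k f (π'.hist k hk.le ω)) (M.law θ π') ∧
          Integrable (fun ω => M.fullBellman θ π k f (π'.hist k hk.le ω)) (M.law θ π') ∧
          (M.law θ π')[fun ω => M.finBellman Z θ π k f (π'.hist k hk.le ω)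
              - M.fullBellman θ π k f (π'.hist k hk.le ω) | π'.pastSigma k hk.le]
            =ᵐ[M.law θ π'] 0) ∧
    (∀ (k : ℕ) (hk : k ≤ M.H),
      MemLp (M.value Z θ π k) ∞ (histMeasure A ρ k) ∧
      ∀ π' : Policy A O, (∀ i, k ≤ i → i < M.H → π'.act i = π.act i) →
        Integrable (fun ω => M.value Z θ π k (π'.hist k hk ω)) (M.law θ π') ∧
        Integrable (M.trajReward π') (M.law θ π') ∧
        (M.law θ π')[fun ω => M.value Z θ π k (π'.hist k hk ω) - M.trajReward π' ω
            | π'.pastSigma k hk]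
          =ᵐ[M.law θ π'] 0) ∧
    (∀ (θ' : Θ) (π' : Policy A O), M.emit θ' 0 = M.emit θ 0 →
      Integrable (fun ω => M.value Z θ π 0 (π'.hist 0 (Nat.zero_le _) ω)) (M.law θ' π') ∧
      M.J θ π = ∫ ω, M.value Z θ π 0 (π'.hist 0 (Nat.zero_le _) ω) ∂(M.law θ' π')) := by
  have hγ0 := hγ.le
  refine ⟨fun k hk f hf => ⟨M.memLp_finBellman hγ0 hZ θ π hk hf, M.memLp_fullBellman θ π hk hf,
    fun π' => ?_⟩, fun k hk => ⟨M.memLp_value hγ0 hZ θ π hk, fun π' hπ => ?_⟩, fun θ' π' hE => ?_⟩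
  · have h1 := M.integrable_law_of_memLp θ π' hk.le (M.memLp_finBellman hγ0 hZ θ π hk hf)
    have h2 := M.integrable_law_of_memLp θ π' hk.le (M.memLp_fullBellman θ π hk hf)
    refine ⟨h1, h2, condExp_ae_eq_zero (π'.pastSigma_le hk.le) (h1.sub h2) fun G hG => ?_⟩
    rw [integral_sub h1.integrableOn h2.integrableOn, sub_eq_zero]
    exact M.setIntegral_finBellman_eq_fullBellman θ π π' hk hγ0 hF hZ hf hG
  · have h1 := M.integrable_law_of_memLp θ π' hk (M.memLp_value hγ0 hZ θ π hk)
    have h2 := M.integrable_trajReward θ π'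
    refine ⟨h1, h2, condExp_ae_eq_zero (π'.pastSigma_le hk) (h1.sub h2) fun G hG => ?_⟩
    rw [integral_sub h1.integrableOn h2.integrableOn, sub_eq_zero]
    exact M.setIntegral_value hγ0 hF hZ θ π π' hk hπ hG
  · have hV := M.memLp_value hγ0 hZ θ π (Nat.zero_le _)
    refine ⟨M.integrable_law_of_memLp θ' π' (Nat.zero_le _) hV, ?_⟩
    have h0 := M.setIntegral_value hγ0 hF hZ θ π π (Nat.zero_le _) (fun _ _ _ => rfl)
      (G := Set.univ) MeasurableSet.univ
    rw [setIntegral_univ, setIntegral_univ] at h0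
    -- A history at step `0` contains no action, so it is the same for every policy, and the
    -- integral depends only on the law of the first step, that is, on the initial density and the
    -- first emission density.
    have key : ∀ (θ₁ : Θ) (π₁ : Policy A O),
        ∫ ω, M.value Z θ π 0 (π₁.hist 0 (Nat.zero_le _) ω) ∂(M.law θ₁ π₁) =
          ∫ x, M.value Z θ π 0 (π.histOf 0 fun i => (x i).2) ∂(M.prefixLaw θ₁ π₁ 1) := by
      intro θ₁ π₁
      have hmp := M.measurePreserving_law θ₁ π₁ (Nat.zero_le _)
      have hm := (M.integrable_prefixLaw_of_memLp θ₁ π₁ (Nat.zero_le _) hV).1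
      have hhist : ∀ o : Fin 1 → O, π₁.histOf 0 o = π.histOf 0 o := fun o =>
        Prod.ext rfl (Subsingleton.elim _ _)
      simp only [hhist] at hm
      rw [← hmp.map_eq] at hm ⊢
      rw [integral_map hmp.aemeasurable hm]
      refine integral_congr_ae (Eventually.of_forall fun ω => ?_)
      simp only [Policy.hist_eq_histOf, hhist]
    rw [POMDPClass.J, ← h0, key θ π, key θ' π', M.prefixLaw_one_congr π π' hE]
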